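/- **Setting.** Let $\mathcal C$ be the category of cubes: its objects are the finite subsets $I,J,\dots$ of a fixed countably infinite set of names, and a morphism $f:J\to I$ is a map $I\to\mathsf{dM}(J)$, where $\mathsf{dM}(J)$ is the free de Morgan algebra on $J$; identities and composition are those of the Kleisli category of $\mathsf{dM}$. For $i\notin I$ let $\deg_i:(I,i)\to I$ be induced by the inclusion $I\subseteq I\cup\{i\}=:(I,i)$, let $(ib):I\to (I,i)$ be the face map sending $i$ to $b\in\{0,1\}$, and for $f:J\to I$, $j\notin J$, let $(f,i{=}j):(J,j)\to(I,i)$ be the extension of $f$ sending $i$ to $j$. Let $\mathbb F(I)$ be the face lattice on $I$: the bounded distributive lattice generated by symbols $(i=0),(i=1)$ $(i\in I)$ with relations $(i=0)\wedge(i=1)=0_{\mathbb F}$. A morphism $f:J\to I$ acts on it by $(i=1)\mapsto (f(i)=1)$ and $(i=0)\mapsto(1-f(i)=1)$, where $r\mapsto (r=1)$ is the lattice map $\mathsf{dM}(J)\to\mathbb F(J)$ sending $j$ to $(j=1)$ and $1-j$ to $(j=0)$. A *cubical set* is a presheaf (of sets) on $\mathcal C$. A *type* (family of types) $E$ over a cubical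 set $\Gamma$ is a presheaf on the category of elements of $\Gamma$: sets $E\rho$ for $\rho\in\Gamma(I)$, with functorial restrictions $E\rho\to E(\rho f)$, $u\mapsto uf$. A *term* of $E$ is a compatible family of elements of the sets $E\rho$. The total space $\Gamma.E=(\rho:\Gamma)\times E(\rho)$ is the cubical set of pairs $(\rho,u)$ with $\rho\in\Gamma(I)$, $u\in E\rho$. Dependent sums and products of types are the usual ones in presheaves. For terms $u,v$ of $E$, an element of $\mathsf{Path}_E(u,v)$ at $\rho\in\Gamma(I)$ is an element $w\in E(\rho\deg_i)$, $i\notin I$, with $w(i0)=u\rho$, $w(i1)=v\rho$, up to renaming of $i$; its restriction along $f:J\to I$ is given by $w(f,i{=}j)$ with $j\notin J$. Put $\mathsf{isContr}\,E=(x:E)\times((y:E)\to\mathsf{Path}_E(x,y))$. A *partial element* of $E$ at $\rho\in\Gamma(I)$ of extent $\varphi\in\mathbb F(I)$ is a family of $u_f\in E(\rho f)$, for all $f:J\to I$ with $\varphi f=1_{\mathbb F}$, such that $(u_f)g=u_{fg}$. A *composition structure* on $E$ assigns to all $I$, $i\notin I$, $\rho\in\Gamma(I,i)$, $\varphi\in\mathbb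 F(I)$, every partial element $u$ of $E$ at $\rho$ of extent $\varphi$ (viewed in $\mathbb F(I,i)$), and every $a_0\in E(\rho(i0))$ with $a_0f=u_{(i0)f}$ whenever $\varphi f=1_{\mathbb F}$, an element $\mathsf{comp}(I,i,\rho,\varphi,u,a_0)\in E(\rho(i1))$, such that $\mathsf{comp}(I,i,\rho,\varphi,u,a_0)f=\mathsf{comp}(J,j,\rho(f,i{=}j),\varphi f,u(f,i{=}j),a_0f)$ for all $f:J\to I$ and $j\notin J$, and $\mathsf{comp}(I,i,\rho,1_{\mathbb F},u,a_0)=u_{(i1)}$. A type $E$ over $\Gamma$ is *contractible* if it has a composition structure and $\mathsf{isContr}\,E$ has a term over $\Gamma$. A *trivial fibration* is a first projection $\Gamma.E\to\Gamma$ with $E$ a contractible type over a cubical set $\Gamma$; a *cofibration* is a map of cubical sets with the left lifting property against all trivial fibrations. For a map $f:A\to B$ of (not necessarily fibrant) cubical sets let $T_f$ be the type over $B$ whose elements at $b\in B(I)$ are the pairs $[\varphi\mapsto a]$ of a face formula $\varphi\in\mathbb F(I)$ and a partial element $a$ of $A$ of extent $\varphi$ (that is, $a_g\in A(J)$ for all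 $g:J\to I$ with $\varphi g=1_{\mathbb F}$, with $(a_g)h=a_{gh}$) such that $f(a_g)=bg$ whenever $\varphi g=1_{\mathbb F}$. Restriction along $h$ takes $[\varphi\mapsto a]$ to $[\varphi h\mapsto ah]$, where $(ah)_g=a_{hg}$. **Theorem.** For every map $f:A\to B$ of cubical sets, the family of types $T_f(b)$, $b:B$, is contractible, and the map $$A\to (b:B)\times T_f(b),\qquad a\mapsto (f\,a,[1_{\mathbb F}\mapsto a])$$ is a cofibration. -/

import Mathlib

open CategoryTheory Opposite

universe u

namespace CubicalSets

/-! ### Free de Morgan algebras -/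

/-- Terms of the language of de Morgan algebras over a set of symbols. -/
inductive DMTerm (α : Type) : Type
  | zero : DMTerm α
  | one : DMTerm α
  | var : α → DMTerm α
  | neg : DMTerm α → DMTerm α
  | inf : DMTerm α → DMTerm α → DMTerm α
  | sup : DMTerm α → DMTerm α → DMTerm α

/-- The congruence on terms generated by the axioms of de Morgan algebras: bounded distributive
lattices with an involution `neg` satisfying the de Morgan laws. -/
inductive DMRel {α : Type} : DMTerm α → DMTerm α → Prop
  | refl (r) : DMRel r r
  | symm {r s} : DMRel r s → DMRel s r
  | trans {r s t} : DMRel r s → DMRel s t → DMRel r t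
  | neg_congr {r r'} : DMRel r r' → DMRel (.neg r) (.neg r')
  | inf_congr {r r' s s'} : DMRel r r' → DMRel s s' → DMRel (.inf r s) (.inf r' s')
  | sup_congr {r r' s s'} : DMRel r r' → DMRel s s' → DMRel (.sup r s) (.sup r' s')
  | inf_comm (r s) : DMRel (.inf r s) (.inf s r)
  | inf_assoc (r s t) : DMRel (.inf (.inf r s) t) (.inf r (.inf s t))
  | sup_comm (r s) : DMRel (.sup r s) (.sup s r)
  | sup_assoc (r s t) : DMRel (.sup (.sup r s) t) (.sup r (.sup s t))
  | sup_inf_self (r s) : DMRel (.sup r (.inf r s)) r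
  | inf_sup_self (r s) : DMRel (.inf r (.sup r s)) r
  | inf_sup (r s t) : DMRel (.inf r (.sup s t)) (.sup (.inf r s) (.inf r t))
  | zero_sup (r) : DMRel (.sup .zero r) r
  | one_inf (r) : DMRel (.inf .one r) r
  | neg_neg (r) : DMRel (.neg (.neg r)) r
  | neg_zero : DMRel (.neg .zero) .one
  | neg_one : DMRel (.neg .one) .zero
  | neg_sup (r s) : DMRel (.neg (.sup r s)) (.inf (.neg r) (.neg s))
  | neg_inf (r s) : DMRel (.neg (.inf r s)) (.sup (.neg r) (.neg s))

instance DMTerm.setoid (α : Type) : Setoid (DMTerm α) where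
  r := DMRel
  iseqv := ⟨DMRel.refl, DMRel.symm, DMRel.trans⟩

/-- The free de Morgan algebra on a set of symbols. -/
def DM (α : Type) : Type := Quotient (DMTerm.setoid α)

namespace DM

variable {α β γ : Type}

/-- A generator. -/
def var (a : α) : DM α := Quotient.mk _ (.var a)

/-- The involution `r ↦ 1 - r`. -/
def neg : DM α → DM α := Quotient.map DMTerm.neg fun _ _ h => DMRel.neg_congr h

instance : Lattice (DM α) :=
  letI : Max (DM α) := ⟨Quotient.map₂ DMTerm.sup fun _ _ h _ _ h' => DMRel.sup_congr h h'⟩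
  letI : Min (DM α) := ⟨Quotient.map₂ DMTerm.inf fun _ _ h _ _ h' => DMRel.inf_congr h h'⟩
  Lattice.mk'
    (by rintro ⟨a⟩ ⟨b⟩; exact Quotient.sound (DMRel.sup_comm a b))
    (by rintro ⟨a⟩ ⟨b⟩ ⟨c⟩; exact Quotient.sound (DMRel.sup_assoc a b c))
    (by rintro ⟨a⟩ ⟨b⟩; exact Quotient.sound (DMRel.inf_comm a b))
    (by rintro ⟨a⟩ ⟨b⟩ ⟨c⟩; exact Quotient.sound (DMRel.inf_assoc a b c))
    (by rintro ⟨a⟩ ⟨b⟩; exact Quotient.sound (DMRel.sup_inf_self a b))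
    (by rintro ⟨a⟩ ⟨b⟩; exact Quotient.sound (DMRel.inf_sup_self a b))

instance : DistribLattice (DM α) where
  le_sup_inf := (DistribLattice.ofInfSupLe (α := DM α)
    (by rintro ⟨a⟩ ⟨b⟩ ⟨c⟩; exact le_of_eq (Quotient.sound (DMRel.inf_sup a b c)))).le_sup_inf

instance : BoundedOrder (DM α) where
  top := Quotient.mk _ .one
  le_top := by rintro ⟨a⟩; exact inf_eq_right.1 (Quotient.sound (DMRel.one_inf a))
  bot := Quotient.mk _ .zero
  bot_le := by rintro ⟨a⟩; exact sup_eq_right.1 (Quotient.sound (DMRel.zero_sup a))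

theorem ind {p : DM α → Prop} (bot : p ⊥) (top : p ⊤) (var : ∀ a, p (var a))
    (neg : ∀ r, p r → p r.neg) (inf : ∀ r s, p r → p s → p (r ⊓ s))
    (sup : ∀ r s, p r → p s → p (r ⊔ s)) (r : DM α) : p r := by
  induction r using Quotient.inductionOn with
  | h r =>
    induction r with
    | zero => exact bot
    | one => exact top
    | var a => exact var a
    | neg r h => exact neg _ h
    | inf r s h h' => exact inf _ _ h h'
    | sup r s h h' => exact sup _ _ h h'

theorem neg_neg (r : DM α) : r.neg.neg = r := by
  obtain ⟨r⟩ := r; exact Quotient.sound (DMRel.neg_neg r)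

theorem neg_bot : (⊥ : DM α).neg = ⊤ := Quotient.sound DMRel.neg_zero

theorem neg_top : (⊤ : DM α).neg = ⊥ := Quotient.sound DMRel.neg_one

theorem neg_sup (r s : DM α) : (r ⊔ s).neg = r.neg ⊓ s.neg := by
  obtain ⟨r⟩ := r; obtain ⟨s⟩ := s; exact Quotient.sound (DMRel.neg_sup r s)

theorem neg_inf (r s : DM α) : (r ⊓ s).neg = r.neg ⊔ s.neg := by
  obtain ⟨r⟩ := r; obtain ⟨s⟩ := s; exact Quotient.sound (DMRel.neg_inf r s)

/-- Evaluation of a term at a substitution of the symbols. -/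
def substTerm (f : α → DM β) : DMTerm α → DM β
  | .zero => ⊥
  | .one => ⊤
  | .var a => f a
  | .neg r => (substTerm f r).neg
  | .inf r s => substTerm f r ⊓ substTerm f s
  | .sup r s => substTerm f r ⊔ substTerm f s

theorem substTerm_rel (f : α → DM β) {r s : DMTerm α} (h : DMRel r s) :
    substTerm f r = substTerm f s := by
  induction h with
  | refl => rfl
  | symm _ h => exact h.symm
  | trans _ _ h h' => exact h.trans h'
  | neg_congr _ h => simp only [substTerm, h]
  | inf_congr _ _ h h' => simp only [substTerm, h, h']
  | sup_congr _ _ h h' => simp only [substTerm, h, h']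
  | inf_comm => exact _root_.inf_comm _ _
  | inf_assoc => exact _root_.inf_assoc _ _ _
  | sup_comm => exact _root_.sup_comm _ _
  | sup_assoc => exact _root_.sup_assoc _ _ _
  | sup_inf_self => exact _root_.sup_inf_self
  | inf_sup_self => exact _root_.inf_sup_self
  | inf_sup => exact inf_sup_left _ _ _
  | zero_sup => exact bot_sup_eq _
  | one_inf => exact top_inf_eq _
  | neg_neg => exact neg_neg _
  | neg_zero => exact neg_bot
  | neg_one => exact neg_top
  | neg_sup => exact neg_sup _ _
  | neg_inf => exact neg_inf _ _

/-- The unique homomorphism of de Morgan algebras extending `f`, i.e. simultaneous substitution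
`r ↦ r f`. -/
def subst (f : α → DM β) : DM α → DM β :=
  Quotient.lift (substTerm f) fun _ _ h => substTerm_rel f h

theorem subst_id (r : DM α) : r.subst var = r := by
  obtain ⟨r⟩ := r
  change substTerm _ r = Quotient.mk _ r
  induction r with
  | zero => rfl
  | one => rfl
  | var a => rfl
  | neg r h => exact congrArg neg h
  | inf r s h h' => exact congrArg₂ (· ⊓ ·) h h'
  | sup r s h h' => exact congrArg₂ (· ⊔ ·) h h'

theorem subst_subst (f : α → DM β) (g : β → DM γ) (r : DM α) :
    (r.subst f).subst g = r.subst fun a => (f a).subst g := by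
  have neg' : ∀ r : DM β, r.neg.subst g = (r.subst g).neg := by rintro ⟨r⟩; rfl
  have inf' : ∀ r s : DM β, (r ⊓ s).subst g = r.subst g ⊓ s.subst g := by
    rintro ⟨r⟩ ⟨s⟩; rfl
  have sup' : ∀ r s : DM β, (r ⊔ s).subst g = r.subst g ⊔ s.subst g := by
    rintro ⟨r⟩ ⟨s⟩; rfl
  obtain ⟨r⟩ := r
  change (substTerm f r).subst g = substTerm _ r
  induction r with
  | zero => rfl
  | one => rfl
  | var a => rfl
  | neg r h => simp only [substTerm, neg', h]
  | inf r s h h' => simp only [substTerm, inf', h, h']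
  | sup r s h h' => simp only [substTerm, sup', h, h']

end DM

/-! ### The face lattice -/

/-- Face formulas over a set of symbols; `eq i b` is the formula `(i = b)`. -/
inductive FaceTerm (α : Type) : Type
  | zero : FaceTerm α
  | one : FaceTerm α
  | eq : α → Bool → FaceTerm α
  | inf : FaceTerm α → FaceTerm α → FaceTerm α
  | sup : FaceTerm α → FaceTerm α → FaceTerm α

/-- The congruence on face formulas generated by the axioms of bounded distributive lattices and
the relation `(i = 0) ∧ (i = 1) = 0`. -/
inductive FaceRel {α : Type} : FaceTerm α → FaceTerm α → Prop
  | refl (r) : FaceRel r r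
  | symm {r s} : FaceRel r s → FaceRel s r
  | trans {r s t} : FaceRel r s → FaceRel s t → FaceRel r t
  | inf_congr {r r' s s'} : FaceRel r r' → FaceRel s s' → FaceRel (.inf r s) (.inf r' s')
  | sup_congr {r r' s s'} : FaceRel r r' → FaceRel s s' → FaceRel (.sup r s) (.sup r' s')
  | inf_comm (r s) : FaceRel (.inf r s) (.inf s r)
  | inf_assoc (r s t) : FaceRel (.inf (.inf r s) t) (.inf r (.inf s t))
  | sup_comm (r s) : FaceRel (.sup r s) (.sup s r)
  | sup_assoc (r s t) : FaceRel (.sup (.sup r s) t) (.sup r (.sup s t))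
  | sup_inf_self (r s) : FaceRel (.sup r (.inf r s)) r
  | inf_sup_self (r s) : FaceRel (.inf r (.sup r s)) r
  | inf_sup (r s t) : FaceRel (.inf r (.sup s t)) (.sup (.inf r s) (.inf r t))
  | zero_sup (r) : FaceRel (.sup .zero r) r
  | one_inf (r) : FaceRel (.inf .one r) r
  | eq_inf_eq (i) : FaceRel (.inf (.eq i false) (.eq i true)) .zero

instance FaceTerm.setoid (α : Type) : Setoid (FaceTerm α) where
  r := FaceRel
  iseqv := ⟨FaceRel.refl, FaceRel.symm, FaceRel.trans⟩

/-- The face lattice on a set of symbols. -/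
def Face (α : Type) : Type := Quotient (FaceTerm.setoid α)

namespace Face

variable {α β γ : Type}

/-- The generator `(i = b)`. -/
def eq (i : α) (b : Bool) : Face α := Quotient.mk _ (.eq i b)

instance : Lattice (Face α) :=
  letI : Max (Face α) := ⟨Quotient.map₂ FaceTerm.sup fun _ _ h _ _ h' => FaceRel.sup_congr h h'⟩
  letI : Min (Face α) := ⟨Quotient.map₂ FaceTerm.inf fun _ _ h _ _ h' => FaceRel.inf_congr h h'⟩
  Lattice.mk'
    (by rintro ⟨a⟩ ⟨b⟩; exact Quotient.sound (FaceRel.sup_comm a b))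
    (by rintro ⟨a⟩ ⟨b⟩ ⟨c⟩; exact Quotient.sound (FaceRel.sup_assoc a b c))
    (by rintro ⟨a⟩ ⟨b⟩; exact Quotient.sound (FaceRel.inf_comm a b))
    (by rintro ⟨a⟩ ⟨b⟩ ⟨c⟩; exact Quotient.sound (FaceRel.inf_assoc a b c))
    (by rintro ⟨a⟩ ⟨b⟩; exact Quotient.sound (FaceRel.sup_inf_self a b))
    (by rintro ⟨a⟩ ⟨b⟩; exact Quotient.sound (FaceRel.inf_sup_self a b))

instance : DistribLattice (Face α) where
  le_sup_inf := (DistribLattice.ofInfSupLe (α := Face α)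
    (by rintro ⟨a⟩ ⟨b⟩ ⟨c⟩; exact le_of_eq (Quotient.sound (FaceRel.inf_sup a b c)))).le_sup_inf

instance : BoundedOrder (Face α) where
  top := Quotient.mk _ .one
  le_top := by rintro ⟨a⟩; exact inf_eq_right.1 (Quotient.sound (FaceRel.one_inf a))
  bot := Quotient.mk _ .zero
  bot_le := by rintro ⟨a⟩; exact sup_eq_right.1 (Quotient.sound (FaceRel.zero_sup a))

theorem eq_inf_eq (i : α) : eq i false ⊓ eq i true = ⊥ :=
  Quotient.sound (FaceRel.eq_inf_eq i)

/-- The formula `(r = b)` for a term `r`: `(r = 1)` is the image of `r` under the lattice map with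
`i ↦ (i = 1)` and `1 - i ↦ (i = 0)`, and `(r = 0)` is `(1 - r = 1)`. -/
def ofTerm : DMTerm α → Bool → Face α
  | .zero, b => if b then ⊥ else ⊤
  | .one, b => if b then ⊤ else ⊥
  | .var i, b => eq i b
  | .neg r, b => ofTerm r (!b)
  | .inf r s, b => if b then ofTerm r b ⊓ ofTerm s b else ofTerm r b ⊔ ofTerm s b
  | .sup r s, b => if b then ofTerm r b ⊔ ofTerm s b else ofTerm r b ⊓ ofTerm s b

theorem ofTerm_rel {r s : DMTerm α} (h : DMRel r s) : ∀ b, ofTerm r b = ofTerm s b := by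
  induction h with
  | refl => exact fun _ => rfl
  | symm _ h => exact fun b => (h b).symm
  | trans _ _ h h' => exact fun b => (h b).trans (h' b)
  | neg_congr _ h => exact fun b => h (!b)
  | inf_congr _ _ h h' => intro b; simp only [ofTerm, h, h']
  | sup_congr _ _ h h' => intro b; simp only [ofTerm, h, h']
  | inf_comm => rintro (_ | _); exacts [_root_.sup_comm _ _, _root_.inf_comm _ _]
  | inf_assoc => rintro (_ | _); exacts [_root_.sup_assoc _ _ _, _root_.inf_assoc _ _ _]
  | sup_comm => rintro (_ | _); exacts [_root_.inf_comm _ _, _root_.sup_comm _ _]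
  | sup_assoc => rintro (_ | _); exacts [_root_.inf_assoc _ _ _, _root_.sup_assoc _ _ _]
  | sup_inf_self => rintro (_ | _); exacts [_root_.inf_sup_self, _root_.sup_inf_self]
  | inf_sup_self => rintro (_ | _); exacts [_root_.sup_inf_self, _root_.inf_sup_self]
  | inf_sup => rintro (_ | _); exacts [sup_inf_left _ _ _, inf_sup_left _ _ _]
  | zero_sup => rintro (_ | _); exacts [top_inf_eq _, bot_sup_eq _]
  | one_inf => rintro (_ | _); exacts [bot_sup_eq _, top_inf_eq _]
  | neg_neg => rintro (_ | _) <;> rfl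
  | neg_zero => rintro (_ | _) <;> rfl
  | neg_one => rintro (_ | _) <;> rfl
  | neg_sup => rintro (_ | _) <;> rfl
  | neg_inf => rintro (_ | _) <;> rfl

/-- The face formula `(r = b)` for `r` in the free de Morgan algebra. -/
def ofDM (r : DM α) (b : Bool) : Face α :=
  Quotient.lift (fun t => ofTerm t b) (fun _ _ h => ofTerm_rel h b) r

theorem ofDM_inf_ofDM (r : DM α) : ofDM r false ⊓ ofDM r true = ⊥ := by
  obtain ⟨r⟩ := r
  change ofTerm r false ⊓ ofTerm r true = ⊥
  induction r with
  | zero => exact inf_bot_eq _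
  | one => exact bot_inf_eq _
  | var i => exact eq_inf_eq i
  | neg r h => exact (inf_comm _ _).trans h
  | inf r s h h' =>
    change (ofTerm r false ⊔ ofTerm s false) ⊓ (ofTerm r true ⊓ ofTerm s true) = ⊥
    rw [inf_sup_right, ← inf_assoc, h, inf_left_comm, h', bot_inf_eq, inf_bot_eq, sup_bot_eq]
  | sup r s h h' =>
    change ofTerm r false ⊓ ofTerm s false ⊓ (ofTerm r true ⊔ ofTerm s true) = ⊥
    rw [inf_sup_left, inf_right_comm, h, inf_assoc, h', bot_inf_eq, inf_bot_eq, sup_bot_eq]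

/-- Evaluation of a face formula at a substitution of the symbols. -/
def substTerm (f : α → DM β) : FaceTerm α → Face β
  | .zero => ⊥
  | .one => ⊤
  | .eq i b => ofDM (f i) b
  | .inf r s => substTerm f r ⊓ substTerm f s
  | .sup r s => substTerm f r ⊔ substTerm f s

theorem substTerm_rel (f : α → DM β) {r s : FaceTerm α} (h : FaceRel r s) :
    substTerm f r = substTerm f s := by
  induction h with
  | refl => rfl
  | symm _ h => exact h.symm
  | trans _ _ h h' => exact h.trans h'
  | inf_congr _ _ h h' => simp only [substTerm, h, h']
  | sup_congr _ _ h h' => simp only [substTerm, h, h']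
  | inf_comm => exact _root_.inf_comm _ _
  | inf_assoc => exact _root_.inf_assoc _ _ _
  | sup_comm => exact _root_.sup_comm _ _
  | sup_assoc => exact _root_.sup_assoc _ _ _
  | sup_inf_self => exact _root_.sup_inf_self
  | inf_sup_self => exact _root_.inf_sup_self
  | inf_sup => exact inf_sup_left _ _ _
  | zero_sup => exact bot_sup_eq _
  | one_inf => exact top_inf_eq _
  | eq_inf_eq => exact ofDM_inf_ofDM _

/-- Substitution `φ ↦ φ f`: the lattice map with `(i = b) ↦ (f i = b)`. -/
def subst (f : α → DM β) : Face α → Face β :=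
  Quotient.lift (substTerm f) fun _ _ h => substTerm_rel f h

theorem subst_top (f : α → DM β) : (⊤ : Face α).subst f = ⊤ := rfl

theorem subst_id (φ : Face α) : φ.subst DM.var = φ := by
  obtain ⟨φ⟩ := φ
  change substTerm _ φ = Quotient.mk _ φ
  induction φ with
  | zero => rfl
  | one => rfl
  | eq i b => rfl
  | inf r s h h' => exact congrArg₂ (· ⊓ ·) h h'
  | sup r s h h' => exact congrArg₂ (· ⊔ ·) h h'

theorem ofDM_neg (r : DM α) (b : Bool) : ofDM r.neg b = ofDM r (!b) := by
  obtain ⟨r⟩ := r; rfl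

theorem ofDM_inf (r s : DM α) (b : Bool) :
    ofDM (r ⊓ s) b = if b then ofDM r b ⊓ ofDM s b else ofDM r b ⊔ ofDM s b := by
  obtain ⟨r⟩ := r; obtain ⟨s⟩ := s; rfl

theorem ofDM_sup (r s : DM α) (b : Bool) :
    ofDM (r ⊔ s) b = if b then ofDM r b ⊔ ofDM s b else ofDM r b ⊓ ofDM s b := by
  obtain ⟨r⟩ := r; obtain ⟨s⟩ := s; rfl

theorem subst_inf (g : α → DM β) (φ ψ : Face α) :
    (φ ⊓ ψ).subst g = φ.subst g ⊓ ψ.subst g := by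
  obtain ⟨φ⟩ := φ; obtain ⟨ψ⟩ := ψ; rfl

theorem subst_sup (g : α → DM β) (φ ψ : Face α) :
    (φ ⊔ ψ).subst g = φ.subst g ⊔ ψ.subst g := by
  obtain ⟨φ⟩ := φ; obtain ⟨ψ⟩ := ψ; rfl

theorem subst_ofDM (g : α → DM β) (r : DM α) (b : Bool) :
    (ofDM r b).subst g = ofDM (r.subst g) b := by
  induction r using DM.ind generalizing b with
  | bot => cases b <;> rfl
  | top => cases b <;> rfl
  | var a => rfl
  | neg r h =>
    have e : r.neg.subst g = (r.subst g).neg := by obtain ⟨r⟩ := r; rfl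
    rw [e, ofDM_neg, ofDM_neg, h]
  | inf r s h h' =>
    have e : (r ⊓ s).subst g = r.subst g ⊓ s.subst g := by
      obtain ⟨r⟩ := r; obtain ⟨s⟩ := s; rfl
    rw [e, ofDM_inf, ofDM_inf, ← h, ← h']
    cases b <;> simp [subst_inf, subst_sup]
  | sup r s h h' =>
    have e : (r ⊔ s).subst g = r.subst g ⊔ s.subst g := by
      obtain ⟨r⟩ := r; obtain ⟨s⟩ := s; rfl
    rw [e, ofDM_sup, ofDM_sup, ← h, ← h']
    cases b <;> simp [subst_inf, subst_sup]

theorem subst_subst (f : α → DM β) (g : β → DM γ) (φ : Face α) :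
    (φ.subst f).subst g = φ.subst fun a => (f a).subst g := by
  obtain ⟨φ⟩ := φ
  change (substTerm f φ).subst g = substTerm _ φ
  induction φ with
  | zero => rfl
  | one => rfl
  | eq i b => exact subst_ofDM g (f i) b
  | inf r s h h' => simp only [substTerm, subst_inf, h, h']
  | sup r s h h' => simp only [substTerm, subst_sup, h, h']

end Face

/-! ### The category of cubes -/

/-- An object of the category of cubes: a finite set of names. The set of all names is `ℕ`. -/
structure Cube : Type where
  names : Finset ℕ

/-- A morphism `J ⟶ I` is a map from `I` to the free de Morgan algebra on `J`. -/
instance : Category.{0} Cube where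
  Hom J I := I.names → DM J.names
  id _ := DM.var
  comp g f := fun i => (f i).subst g
  id_comp f := funext fun i => DM.subst_id (f i)
  comp_id _ := rfl
  assoc h g f := funext fun i => (DM.subst_subst g h (f i)).symm

namespace Cube

theorem comp_apply {K J I : Cube} (g : K ⟶ J) (f : J ⟶ I) (i : I.names) :
    (g ≫ f) i = (f i).subst g := rfl

/-- The set of names `I, i`. -/
def extend (I : Cube) (i : ℕ) : Cube := ⟨insert i I.names⟩

/-- The map `I, i ⟶ I` induced by the inclusion `I ⊆ I, i`. -/
def deg (I : Cube) (i : ℕ) : I.extend i ⟶ I :=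
  fun k => DM.var ⟨k.1, Finset.mem_insert_of_mem k.2⟩

/-- The name `i` as an element of the free de Morgan algebra on `I, i`. -/
def last (I : Cube) (i : ℕ) : DM (I.extend i).names :=
  DM.var ⟨i, Finset.mem_insert_self i I.names⟩

/-- The map `(f, i = r) : J ⟶ I, i` for `f : J ⟶ I`. -/
def cons {J I : Cube} (f : J ⟶ I) (i : ℕ) (r : DM J.names) : J ⟶ I.extend i :=
  fun k => if h : k.1 = i then r else f ⟨k.1, (Finset.mem_insert.1 k.2).resolve_left h⟩

/-- The map `(f, i = j) : J, j ⟶ I, i` for `f : J ⟶ I`. -/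
def lift {J I : Cube} (f : J ⟶ I) (i j : ℕ) : J.extend j ⟶ I.extend i :=
  cons (J.deg j ≫ f) i (J.last j)

/-- The face map `(i b) : I ⟶ I, i` for `b = 0, 1`. -/
def face (I : Cube) (i : ℕ) (b : Bool) : I ⟶ I.extend i :=
  cons (𝟙 I) i (if b then ⊤ else ⊥)

/-- A name that is not in `I`. -/
def fresh (I : Cube) : ℕ := I.names.sup id + 1

theorem fresh_notMem (I : Cube) : I.fresh ∉ I.names := fun h =>
  absurd (Finset.le_sup (f := id) h) (Nat.not_succ_le_self _)

theorem cons_deg {J I : Cube} (f : J ⟶ I) {i : ℕ} (hi : i ∉ I.names) (r : DM J.names) :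
    cons f i r ≫ I.deg i = f := by
  funext k
  have h : (k : ℕ) ≠ i := fun h => hi (h ▸ k.2)
  exact dif_neg h

theorem cons_last {J I : Cube} (f : J ⟶ I) (i : ℕ) (r : DM J.names) :
    (I.last i).subst (cons f i r) = r := dif_pos rfl

theorem comp_cons {K J I : Cube} (g : K ⟶ J) (f : J ⟶ I) (i : ℕ) (r : DM J.names) :
    g ≫ cons f i r = cons (g ≫ f) i (r.subst g) := by
  funext k
  rw [comp_apply]
  by_cases h : (k : ℕ) = i
  · simp only [cons, dif_pos h]
  · simp only [cons, dif_neg h, comp_apply]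

theorem cons_lift {K J I : Cube} (g : K ⟶ J) (f : J ⟶ I) (i : ℕ) {j : ℕ} (hj : j ∉ J.names)
    (r : DM K.names) : cons g j r ≫ lift f i j = cons (g ≫ f) i r := by
  rw [lift, comp_cons, cons_last, ← Category.assoc, cons_deg g hj]

theorem lift_deg {J I : Cube} (f : J ⟶ I) {i : ℕ} (hi : i ∉ I.names) (j : ℕ) :
    lift f i j ≫ I.deg i = J.deg j ≫ f := cons_deg _ hi _

theorem face_deg (I : Cube) {i : ℕ} (hi : i ∉ I.names) (b : Bool) :
    I.face i b ≫ I.deg i = 𝟙 I := cons_deg _ hi _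

theorem face_lift {J I : Cube} (f : J ⟶ I) (i : ℕ) {j : ℕ} (hj : j ∉ J.names) (b : Bool) :
    J.face j b ≫ lift f i j = f ≫ I.face i b := by
  rw [face, cons_lift _ _ _ hj, face, comp_cons, Category.id_comp, Category.comp_id]
  cases b <;> rfl

theorem lift_id (I : Cube) (i : ℕ) : lift (𝟙 I) i i = 𝟙 (I.extend i) := by
  funext k
  rw [lift, Category.comp_id]
  by_cases h : (k : ℕ) = i
  · obtain ⟨k, hk⟩ := k
    obtain rfl : k = i := h
    exact dif_pos rfl
  · exact dif_neg h

theorem lift_comp {K J I : Cube} (g : K ⟶ J) (f : J ⟶ I) (i : ℕ) {j : ℕ} (hj : j ∉ J.names)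
    (k : ℕ) : lift g j k ≫ lift f i j = lift (g ≫ f) i k := by
  rw [lift, cons_lift _ _ _ hj, Category.assoc, lift]

end Cube

/-! ### Cubical sets, types in context, and terms -/

/-- Cubical sets are presheaves on the category of cubes. -/
abbrev CSet : Type (u + 1) := Cubeᵒᵖ ⥤ Type u

/-- A type in context `Γ`: a presheaf on the category of elements of `Γ`. An object of `Γ.Elements`
is a pair of some `I` and `ρ ∈ Γ(I)`; a morphism from `(I, ρ)` to `(J, ρ')` is an `f : J ⟶ I` with
`ρ f = ρ'`, and the corresponding map `A ρ → A ρ'` is the restriction `a ↦ a f`. -/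
abbrev Ty (Γ : CSet.{u}) : Type (u + 1) := Γ.Elements ⥤ Type u

/-- The element `ρ f` for `x = (I, ρ)` and `f : J ⟶ I`. -/
abbrev res {Γ : CSet.{u}} (x : Γ.Elements) {J : Cube} (f : J ⟶ x.1.unop) : Γ.Elements :=
  ⟨op J, Γ.map f.op x.2⟩

/-- The morphism from `ρ` to `ρ f` given by `f`. -/
abbrev resHom {Γ : CSet.{u}} (x : Γ.Elements) {J : Cube} (f : J ⟶ x.1.unop) : x ⟶ res x f :=
  ⟨f.op, rfl⟩

/-- The morphism from `ρ f` to `ρ' f'` given by `h`, where `ρ' = ρ g` and `f h = g f'`. -/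
def resMap {Γ : CSet.{u}} {x y : Γ.Elements} (g : x ⟶ y) {J K : Cube} (f : J ⟶ x.1.unop)
    (f' : K ⟶ y.1.unop) (h : K ⟶ J) (w : h ≫ f = f' ≫ g.1.unop) : res x f ⟶ res y f' :=
  ⟨h.op, by
    have e : f.op ≫ h.op = g.1 ≫ f'.op := congrArg Quiver.Hom.op w
    change Γ.map h.op (Γ.map f.op x.2) = Γ.map f'.op y.2
    rw [← g.2, ← Functor.map_comp_apply, e, Functor.map_comp_apply]⟩

/-- The face formula `φ` restricted along a morphism from `(I, ρ)` to `(J, ρ')`. -/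
abbrev restrictFace {Γ : CSet.{u}} {x y : Γ.Elements} (g : x ⟶ y) (φ : Face x.1.unop.names) :
    Face y.1.unop.names := φ.subst g.1.unop

theorem restrictFace_id {Γ : CSet.{u}} (x : Γ.Elements) (φ : Face x.1.unop.names) :
    restrictFace (𝟙 x) φ = φ := Face.subst_id φ

theorem restrictFace_comp {Γ : CSet.{u}} {x y z : Γ.Elements} (g : x ⟶ y) (h : y ⟶ z)
    (φ : Face x.1.unop.names) : restrictFace (g ≫ h) φ = restrictFace h (restrictFace g φ) :=
  (Face.subst_subst _ _ φ).symm

namespace Ty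

variable {Γ Δ : CSet.{u}}

/-- The terms of type `A` in context `Γ`: families of `a ρ ∈ A ρ` with `(a ρ) f = a (ρ f)`. -/
abbrev Ter (A : Ty Γ) : Type u := A.sections

/-- The type `A σ` in context `Δ`, for `σ : Δ ⟶ Γ`. -/
abbrev sub (A : Ty Γ) (σ : Δ ⟶ Γ) : Ty Δ := CategoryOfElements.map σ ⋙ A

/-- The term `a σ` of type `A σ`. -/
def Ter.sub {A : Ty Γ} (a : A.Ter) (σ : Δ ⟶ Γ) : (A.sub σ).Ter :=
  ⟨fun x => a.1 ((CategoryOfElements.map σ).obj x),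
    fun f => a.2 ((CategoryOfElements.map σ).map f)⟩

/-- A cubical set `A` as a type in context `Γ`. -/
abbrev const (Γ A : CSet.{u}) : Ty Γ := CategoryOfElements.π Γ ⋙ A

theorem map_map (A : Ty Γ) {x y z : Γ.Elements} (g : x ⟶ y) (h : y ⟶ z) (k : x ⟶ z)
    (e : g.1 ≫ h.1 = k.1) (a : A.obj x) : A.map h (A.map g a) = A.map k a := by
  obtain rfl : g ≫ h = k := Subtype.ext e
  exact (Functor.map_comp_apply A g h a).symm

theorem map_of_val_eq_id (A : Ty Γ) {x : Γ.Elements} (g : x ⟶ x) (e : g.1 = 𝟙 _)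
    (a : A.obj x) : A.map g a = a := by
  obtain rfl : g = 𝟙 x := Subtype.ext e
  exact Functor.map_id_apply A _ a

theorem total_ext (A : Ty Γ) {I : Cubeᵒᵖ} {ρ ρ' : Γ.obj I} (h : ρ = ρ') {a : A.obj ⟨I, ρ⟩}
    {a' : A.obj ⟨I, ρ'⟩} (g : Γ.elementsMk I ρ ⟶ Γ.elementsMk I ρ') (hg : g.1 = 𝟙 I)
    (ha : A.map g a = a') :
    (⟨ρ, a⟩ : Σ ρ : Γ.obj I, A.obj ⟨I, ρ⟩) = ⟨ρ', a'⟩ := by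
  subst h
  rw [map_of_val_eq_id A g hg] at ha
  rw [ha]

/-- The cubical set `Γ.A`, whose elements at stage `I` are the pairs `(ρ, a)` with `ρ ∈ Γ(I)` and
`a ∈ A ρ`. -/
def total (A : Ty Γ) : CSet.{u} where
  obj I := Σ ρ : Γ.obj I, A.obj ⟨I, ρ⟩
  map {I J} f := ↾fun p =>
    ⟨Γ.map f p.1, A.map (CategoryOfElements.homMk ⟨I, p.1⟩ ⟨J, Γ.map f p.1⟩ f rfl) p.2⟩
  map_id I := by
    ext ⟨ρ, a⟩ : 3
    have e : Γ.map (𝟙 I) ρ = ρ := Functor.map_id_apply Γ _ ρ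
    refine total_ext A e (CategoryOfElements.homMk _ _ (𝟙 I)
      ((Functor.map_id_apply Γ _ _).trans e)) rfl ?_
    exact (map_map A _ _ (𝟙 _) (Category.id_comp _) a).trans (map_of_val_eq_id A _ rfl a)
  map_comp {I J K} f g := by
    ext ⟨ρ, a⟩ : 3
    have e : Γ.map (f ≫ g) ρ = Γ.map g (Γ.map f ρ) := Functor.map_comp_apply Γ f g ρ
    refine total_ext A e (CategoryOfElements.homMk _ _ (𝟙 K)
      ((Functor.map_id_apply Γ _ _).trans e)) rfl ?_
    refine (map_map A _ _ (CategoryOfElements.homMk ⟨I, ρ⟩ ⟨K, Γ.map g (Γ.map f ρ)⟩ (f ≫ g) e)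
      (Category.comp_id _) a).trans ?_
    exact (map_map A _ _ _ rfl a).symm

/-- The first projection `p : Γ.A ⟶ Γ`. -/
def p (A : Ty Γ) : A.total ⟶ Γ where
  app _ := ↾fun w => w.1

/-- The second projection, a term of type `A p` in context `Γ.A`. -/
def q (A : Ty Γ) : (A.sub A.p).Ter :=
  ⟨fun x => x.2.2, by
    rintro ⟨I, ρ, a⟩ ⟨J, w⟩ ⟨f, hf⟩
    change I ⟶ J at f
    change A.total.map f ⟨ρ, a⟩ = w at hf
    subst hf
    rfl⟩

/-- The element `(ρ, a)` of `Γ.A`. -/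
abbrev pt (A : Ty Γ) (x : Γ.Elements) (a : A.obj x) : A.total.Elements := ⟨x.1, ⟨x.2, a⟩⟩

/-- The morphism from `(ρ, a)` to `(ρ f, a f)` given by `f`. -/
def ptHom (A : Ty Γ) {x y : Γ.Elements} (g : x ⟶ y) (a : A.obj x) :
    A.pt x a ⟶ A.pt y (A.map g a) :=
  ⟨g.1, by
    obtain ⟨I, ρ⟩ := x
    obtain ⟨J, ρ'⟩ := y
    obtain ⟨f, hf⟩ := g
    change I ⟶ J at f
    change Γ.map f ρ = ρ' at hf
    subst hf
    rfl⟩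

theorem sigma_ext (A : Ty Γ) (B : Ty A.total) {x : Γ.Elements} {a a' : A.obj x} (h : a = a')
    {b : B.obj (A.pt x a)} {b' : B.obj (A.pt x a')} (g : A.pt x a ⟶ A.pt x a') (hg : g.1 = 𝟙 x.1)
    (hb : B.map g b = b') : (⟨a, b⟩ : Σ a : A.obj x, B.obj (A.pt x a)) = ⟨a', b'⟩ := by
  subst h
  rw [map_of_val_eq_id B g hg] at hb
  rw [hb]

/-- The dependent sum type. -/
def sigma (A : Ty Γ) (B : Ty A.total) : Ty Γ where
  obj x := Σ a : A.obj x, B.obj (A.pt x a)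
  map g := ↾fun w => ⟨A.map g w.1, B.map (A.ptHom g w.1) w.2⟩
  map_id x := by
    ext ⟨a, b⟩ : 3
    have e : A.map (𝟙 x) a = a := Functor.map_id_apply A _ a
    refine sigma_ext A B e ⟨𝟙 _, ?_⟩ rfl ?_
    · exact (Functor.map_id_apply A.total _ _).trans (congrArg (Sigma.mk x.2) e)
    · exact (map_map B _ _ (𝟙 _) (Category.id_comp _) b).trans (map_of_val_eq_id B _ rfl b)
  map_comp {x y z} g h := by
    ext ⟨a, b⟩ : 3
    have e : A.map (g ≫ h) a = A.map h (A.map g a) := Functor.map_comp_apply A g h a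
    refine sigma_ext A B e ⟨𝟙 _, ?_⟩ rfl ?_
    · exact (Functor.map_id_apply A.total _ _).trans (congrArg (Sigma.mk z.2) e)
    · refine (map_map B _ _ (A.ptHom g a ≫ A.ptHom h _) (Category.comp_id _) b).trans ?_
      exact (map_map B _ _ _ rfl b).symm

/-- The dependent product type: at `ρ ∈ Γ(I)`, families of functions `w_f` for `f : J ⟶ I`, taking
`a ∈ A (ρ f)` to `w_f a ∈ B (ρ f, a)`, with `(w_f a) g = w_{f g} (a g)`. -/
def pi (A : Ty Γ) (B : Ty A.total) : Ty Γ where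
  obj x := { w : ∀ ⦃y : Γ.Elements⦄, (x ⟶ y) → ∀ a : A.obj y, B.obj (A.pt y a) //
    ∀ ⦃y z : Γ.Elements⦄ (g : x ⟶ y) (h : y ⟶ z) (a : A.obj y),
      B.map (A.ptHom h a) (w g a) = w (g ≫ h) (A.map h a) }
  map k := ↾fun w => ⟨fun _ g a => w.1 (k ≫ g) a, fun y z g h a => by
    rw [w.2 (k ≫ g) h a, Category.assoc]⟩
  map_id x := by
    ext w : 3
    refine Subtype.ext ?_
    funext y g a
    exact congrArg (fun k => w.1 k a) (Category.id_comp g)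
  map_comp k l := by
    ext w : 3
    refine Subtype.ext ?_
    funext y g a
    exact congrArg (fun k => w.1 k a) (Category.assoc k l g)

/-! ### Path types and contractibility -/

/-- For `x = (I, ρ)` and `i` fresh for `I`, the element `ρ` weakened to `I, i`. -/
abbrev weaken (x : Γ.Elements) : Γ.Elements := res x (x.1.unop.deg x.1.unop.fresh)

/-- The morphism `(f, i = j)` between weakened elements. -/
def weakenMap {x y : Γ.Elements} (g : x ⟶ y) : weaken x ⟶ weaken y :=
  resMap g _ _ (Cube.lift g.1.unop x.1.unop.fresh y.1.unop.fresh)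
    (Cube.lift_deg _ x.1.unop.fresh_notMem _)

/-- The face morphism `(i b)` from a weakened element back to the element. -/
def weakenFace (x : Γ.Elements) (b : Bool) : weaken x ⟶ x :=
  ⟨(x.1.unop.face x.1.unop.fresh b).op, by
    change Γ.map _ (Γ.map _ x.2) = x.2
    rw [← Functor.map_comp_apply, ← op_comp, Cube.face_deg _ x.1.unop.fresh_notMem]
    exact Functor.map_id_apply Γ _ x.2⟩

theorem weakenMap_face {x y : Γ.Elements} (g : x ⟶ y) (b : Bool) :
    weakenMap g ≫ weakenFace y b = weakenFace x b ≫ g :=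
  Subtype.ext (congrArg Quiver.Hom.op
    (Cube.face_lift g.1.unop x.1.unop.fresh y.1.unop.fresh_notMem b))

/-- The type of paths from `u` to `v` in `A`. An element at `ρ ∈ Γ(I)` is a name abstraction
`⟨i⟩ w` with `i ∉ I` and `w ∈ A (ρ deg_i)` such that `w (i0) = u ρ` and `w (i1) = v ρ`, up to
renaming of `i`; each class has exactly one representative in which `i` is the name
`Cube.fresh I`, and we use this representative. Restriction is `(⟨i⟩ w) f = ⟨j⟩ w (f, i = j)`. -/
def path (A : Ty Γ) (u v : A.Ter) : Ty Γ where
  obj x := { w : A.obj (weaken x) //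
    A.map (weakenFace x false) w = u.1 x ∧ A.map (weakenFace x true) w = v.1 x }
  map {x y} g := ↾fun w => ⟨A.map (weakenMap g) w.1, by
    constructor
    · rw [← Functor.map_comp_apply, weakenMap_face, Functor.map_comp_apply, w.2.1, u.2 g]
    · rw [← Functor.map_comp_apply, weakenMap_face, Functor.map_comp_apply, w.2.2, v.2 g]⟩
  map_id x := by
    ext w : 3
    refine Subtype.ext (map_of_val_eq_id A _ ?_ w.1)
    exact congrArg Quiver.Hom.op (Cube.lift_id _ _)
  map_comp {x y z} g h := by
    ext w : 3
    refine Subtype.ext (map_map A _ _ _ ?_ w.1).symm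
    exact congrArg Quiver.Hom.op
      (Cube.lift_comp h.1.unop g.1.unop _ y.1.unop.fresh_notMem _)

/-- The type `(x : A) × ((y : A) → Path A x y)`. -/
def isContr (A : Ty Γ) : Ty Γ :=
  sigma A (pi (A.sub A.p) (path ((A.sub A.p).sub (A.sub A.p).p) (A.q.sub (A.sub A.p).p)
    (A.sub A.p).q))

/-! ### Partial elements and composition structures -/

/-- A partial element of `A ρ` of extent `φ`: a family of `u_f ∈ A (ρ f)` for all `f` with
`φ f = 1`, such that `(u_f) g = u_{f g}`. -/
@[ext]
structure PartialElt (A : Ty Γ) (x : Γ.Elements) (φ : Face x.1.unop.names) : Type u where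
  val : ∀ ⦃y : Γ.Elements⦄ (g : x ⟶ y), restrictFace g φ = ⊤ → A.obj y
  map_val : ∀ ⦃y z : Γ.Elements⦄ (g : x ⟶ y) (h : y ⟶ z) (hg : restrictFace g φ = ⊤)
    (hgh : restrictFace (g ≫ h) φ = ⊤), A.map h (val g hg) = val (g ≫ h) hgh

theorem PartialElt.val_congr {A : Ty Γ} {x : Γ.Elements} {φ : Face x.1.unop.names}
    (u : PartialElt A x φ) {y : Γ.Elements} {g g' : x ⟶ y} (e : g = g')
    (hg : restrictFace g φ = ⊤) (hg' : restrictFace g' φ = ⊤) : u.val g hg = u.val g' hg' := by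
  subst e; rfl

/-- The restriction `u k` of a partial element of extent `φ`, of extent `ψ = φ k`. -/
def PartialElt.restrict {A : Ty Γ} {x y : Γ.Elements} {φ : Face x.1.unop.names}
    (u : PartialElt A x φ) (k : x ⟶ y) (ψ : Face y.1.unop.names) (hψ : restrictFace k φ = ψ) :
    PartialElt A y ψ where
  val _ g hg := u.val (k ≫ g) (by rw [restrictFace_comp, hψ, hg])
  map_val y z g h hg hgh := by
    rw [u.map_val (k ≫ g) h _ (by rw [Category.assoc, restrictFace_comp, hψ, hgh])]
    exact u.val_congr (Category.assoc k g h) _ _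

/-- The data to which a composition operation applies: `ρ ∈ Γ(I, i)`, a face formula `φ` on `I`,
a partial element `u` of `A ρ` of extent `φ`, and `a₀ ∈ A ρ(i0)` with `a₀ f = u_{(i0) f}` for all
`f : J ⟶ I` with `φ f = 1`. -/
structure Box (A : Ty Γ) (I : Cube) (i : ℕ) (hi : i ∉ I.names) : Type u where
  ρ : Γ.obj (op (I.extend i))
  φ : Face I.names
  u : PartialElt A (Γ.elementsMk (op (I.extend i)) ρ) (φ.subst (I.deg i))
  a₀ : A.obj (res (Γ.elementsMk (op (I.extend i)) ρ) (I.face i false))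
  compat : ∀ ⦃y : Γ.Elements⦄ (g : res (Γ.elementsMk (op (I.extend i)) ρ) (I.face i false) ⟶ y)
    (_ : restrictFace g φ = ⊤)
    (hg : restrictFace (resHom (Γ.elementsMk (op (I.extend i)) ρ) (I.face i false) ≫ g)
      (φ.subst (I.deg i)) = ⊤),
    A.map g a₀ = u.val (resHom (Γ.elementsMk (op (I.extend i)) ρ) (I.face i false) ≫ g) hg

namespace Box

variable {A : Ty Γ} {I J : Cube} {i j : ℕ} {hi : i ∉ I.names} {hj : j ∉ J.names}

/-- The element `ρ (i b)` for `b = 0, 1`. -/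
abbrev side (P : Box A I i hi) (b : Bool) : Γ.Elements :=
  res (Γ.elementsMk (op (I.extend i)) P.ρ) (I.face i b)

/-- The face morphism from `ρ` to `ρ (i b)`. -/
abbrev sideHom (P : Box A I i hi) (b : Bool) :
    Γ.elementsMk (op (I.extend i)) P.ρ ⟶ P.side b := resHom _ _

theorem extent_side (P : Box A I i hi) (b : Bool) :
    restrictFace (P.sideHom b) (P.φ.subst (I.deg i)) = P.φ := by
  refine (Face.subst_subst _ _ P.φ).trans ?_
  refine Eq.trans ?_ (Face.subst_id P.φ)
  exact congrArg (fun f => P.φ.subst f) (I.face_deg hi b)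

/-- The morphism from `ρ (i b)` to `ρ (f, i = j) (j b)` given by `f`. -/
def sideMap (P : Box A I i hi) (f : J ⟶ I) (hj : j ∉ J.names) (b : Bool) :
    P.side b ⟶ res (res (Γ.elementsMk (op (I.extend i)) P.ρ) (Cube.lift f i j)) (J.face j b) :=
  resMap (resHom (Γ.elementsMk (op (I.extend i)) P.ρ) (Cube.lift f i j)) _ _ f (Cube.face_lift f i hj b).symm

/-- The data `ρ (f, i = j)`, `φ f`, `u (f, i = j)`, `a₀ f`. -/
def restrict (P : Box A I i hi) (f : J ⟶ I) (hj : j ∉ J.names) : Box A J j hj where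
  ρ := Γ.map (Cube.lift f i j).op P.ρ
  φ := P.φ.subst f
  u := P.u.restrict (resHom _ (Cube.lift f i j)) _ (by
    refine (Face.subst_subst _ _ P.φ).trans (Eq.trans ?_ (Face.subst_subst _ _ P.φ).symm)
    exact congrArg (fun f => P.φ.subst f) (Cube.lift_deg f hi j))
  a₀ := A.map (P.sideMap f hj false) P.a₀
  compat y g hg' hg := by
    have h₁ : restrictFace (P.sideMap f hj false ≫ g) P.φ = ⊤ :=
      (restrictFace_comp (P.sideMap f hj false) g P.φ).trans hg'
    have h₂ : restrictFace (P.sideHom false ≫ P.sideMap f hj false ≫ g)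
        (P.φ.subst (I.deg i)) = ⊤ := by
      rw [restrictFace_comp, P.extent_side, h₁]
    rw [← Functor.map_comp_apply, P.compat _ h₁ h₂]
    refine P.u.val_congr (Subtype.ext ?_) _ _
    change (I.face i false).op ≫ f.op ≫ g.1 = (Cube.lift f i j).op ≫ (J.face j false).op ≫ g.1
    rw [← Category.assoc, ← Category.assoc, ← op_comp, ← op_comp, Cube.face_lift f i hj]

end Box

/-- A composition structure on `A`: an operation that takes `(ρ, φ, u, a₀)` to an element of
`A ρ(i1)`, commutes with restriction along every `f : J ⟶ I`, and equals `u_{(i1)}` if `φ = 1`. -/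
structure CompStructure (A : Ty Γ) : Type u where
  comp : ∀ {I : Cube} {i : ℕ} {hi : i ∉ I.names} (P : Box A I i hi), A.obj (P.side true)
  comp_restrict : ∀ {I J : Cube} {i j : ℕ} {hi : i ∉ I.names} (hj : j ∉ J.names)
    (P : Box A I i hi) (f : J ⟶ I), A.map (P.sideMap f hj true) (comp P) = comp (P.restrict f hj)
  comp_top : ∀ {I : Cube} {i : ℕ} {hi : i ∉ I.names} (P : Box A I i hi) (h : P.φ = ⊤),
    comp P = P.u.val (P.sideHom true) ((P.extent_side true).trans h)

/-- A contractible family of types over `Γ`: a fibrant type `A` in context `Γ` (one that has a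
composition structure) such that `isContr A` has a term in context `Γ`. -/
def IsContractible (A : Ty Γ) : Prop :=
  Nonempty A.CompStructure ∧ Nonempty A.isContr.Ter

end Ty

/-! ### Trivial fibrations and cofibrations -/

/-- Trivial fibrations are the first projections `Γ.E ⟶ Γ` of contractible families. -/
inductive trivialFibrations : MorphismProperty CSet.{u}
  | proj (Γ : CSet.{u}) (E : Ty Γ) (hE : E.IsContractible) : trivialFibrations E.p

/-- Cofibrations are the maps that have the left lifting property against trivial fibrations. -/
def cofibrations : MorphismProperty CSet.{u} := trivialFibrations.llp

/-! ### The factorization -/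

section Factorization

variable {A B : CSet.{u}} (f : A ⟶ B)

/-- An element `[φ ↦ a]` of `T_f(b)` at stage `I`, for `x = (I, b)` with `b ∈ B(I)`: a face formula
`φ` on `I` and a partial element `a` of `A` of extent `φ` with `f a = b` on `φ`. -/
structure PartialPreimage (x : B.Elements) : Type u where
  φ : Face x.1.unop.names
  a : Ty.PartialElt (Ty.const B A) x φ
  map_a : ∀ ⦃y : B.Elements⦄ (g : x ⟶ y) (hg : restrictFace g φ = ⊤), f.app y.1 (a.val g hg) = y.2

variable {f} in
theorem PartialPreimage.ext {x : B.Elements} {s t : PartialPreimage f x} (h : s.φ = t.φ)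
    (ha : ∀ ⦃y : B.Elements⦄ (g : x ⟶ y) (hs : restrictFace g s.φ = ⊤)
      (ht : restrictFace g t.φ = ⊤), s.a.val g hs = t.a.val g ht) : s = t := by
  obtain ⟨φ, a, _⟩ := s
  obtain ⟨ψ, a', _⟩ := t
  obtain rfl : φ = ψ := h
  obtain rfl : a = a' := Ty.PartialElt.ext (by funext y g hg; exact ha g hg hg)
  rfl

/-- The family of types `T_f(b)`, for `b : B`. -/
def T : Ty B where
  obj x := PartialPreimage f x
  map k := ↾fun s =>
    { φ := restrictFace k s.φ
      a := s.a.restrict k _ rfl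
      map_a := fun _ g hg => s.map_a (k ≫ g) _ }
  map_id x := by
    ext s : 3
    refine PartialPreimage.ext (restrictFace_id x s.φ) fun y g _ _ => ?_
    exact s.a.val_congr (Category.id_comp g) _ _
  map_comp k l := by
    ext s : 3
    refine PartialPreimage.ext (restrictFace_comp k l s.φ) fun y g _ _ => ?_
    exact s.a.val_congr (Category.assoc k l g) _ _

/-- The element `[1 ↦ a]` of `T_f(f a)`. -/
def totalPreimage {I : Cubeᵒᵖ} (a : A.obj I) : PartialPreimage f ⟨I, f.app I a⟩ where
  φ := ⊤
  a :=
    { val := fun _ g _ => A.map g.1 a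
      map_val := fun _ _ g h _ _ => (Functor.map_comp_apply A g.1 h.1 a).symm }
  map_a _ g _ := (NatTrans.naturality_apply f g.1 a).trans g.2

/-- The map `A ⟶ (b : B) × T_f(b)`, `a ↦ (f a, [1 ↦ a])`. -/
def toTotal : A ⟶ (T f).total where
  app I := ↾fun a => ⟨f.app I a, totalPreimage f a⟩
  naturality {I J} g := by
    ext a : 3
    have e : f.app J (A.map g a) = B.map g (f.app I a) := NatTrans.naturality_apply f g a
    refine Ty.total_ext (T f) e (CategoryOfElements.homMk _ _ (𝟙 J)
      ((Functor.map_id_apply B _ _).trans e)) rfl ?_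
    refine PartialPreimage.ext rfl fun y h _ _ => ?_
    change A.map (𝟙 J ≫ h.1) (A.map g a) = A.map (g ≫ h.1) a
    rw [Category.id_comp, Functor.map_comp_apply]

end Factorization

end CubicalSets

/-! The argument rests on a uniform extension operation: every partial element of a type, of any
extent, extends to a total one, compatibly with restriction (`Ty.ExtensionStructure`). Such an
operation gives a composition structure, by extending the part of the box over the face `i = 1`.
Conversely, a contractible type has one: compose, over the constant line, the paths from the center
to the given partial element (`Contraction.extensionStructure`).

The types `T_f(b)` have this operation because partial elements of partial elements glue. If `[φ_g ↦
a_g]` is a compatible family on the extent `φ`, the wanted extent `ψ` must be true along `g` exactly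
when `φ g = 1` and `φ_g = 1`. Such a formula exists (`Face.exists_glue`) because a cube has finitely
many faces: take the disjunction of the faces on which the condition holds. It is unique because
face formulas are determined by the maps along which they are true (`Face.ext_of_subst_eq_top`), and
uniqueness makes the gluing uniform. Both facts use that `1` is join-prime in the face lattice, so
that an equation `(r = b)` is true only if `r` is the endpoint `b`. The family contracts to the
empty partial element through `[(i = 1) ∧ φ ↦ a]`.

For the lifting property, take a square with `α : A ⟶ Γ.E` on top and `β` below. A point `w = (b, [φ
↦ a])` gives the partial element `α(a)` of `E` at `β w`, of extent `φ`. Extending it defines the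
lift. Uniformity makes the lift natural, and on `[1 ↦ a]` the extension returns `α a`. -/

namespace CubicalSets

namespace DM

variable {α β : Type}

/-- The endpoint `0` or `1` of the interval. -/
def ofBool (b : Bool) : DM α := if b then ⊤ else ⊥

theorem subst_ofBool (g : α → DM β) (b : Bool) : (ofBool b : DM α).subst g = ofBool b := by
  cases b <;> rfl

end DM

/-! ### Face formulas and the faces on which they are true -/

namespace Face

variable {α β : Type}

theorem ind {p : Face α → Prop} (bot : p ⊥) (top : p ⊤) (eq : ∀ i b, p (eq i b))
    (inf : ∀ φ ψ, p φ → p ψ → p (φ ⊓ ψ)) (sup : ∀ φ ψ, p φ → p ψ → p (φ ⊔ ψ)) (φ : Face α) :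
    p φ := by
  induction φ using Quotient.inductionOn with
  | h φ =>
    induction φ with
    | zero => exact bot
    | one => exact top
    | eq i b => exact eq i b
    | inf r s h h' => exact inf _ _ h h'
    | sup r s h h' => exact sup _ _ h h'

/-- Truth of a face formula when every `(i = b)` is read as false. -/
def holdsTerm : FaceTerm α → Prop
  | .zero => False
  | .one => True
  | .eq _ _ => False
  | .inf r s => holdsTerm r ∧ holdsTerm s
  | .sup r s => holdsTerm r ∨ holdsTerm s

theorem holdsTerm_rel {r s : FaceTerm α} (h : FaceRel r s) : holdsTerm r ↔ holdsTerm s := by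
  induction h <;> (try simp only [holdsTerm]) <;> tauto

/-- The lattice map to the truth values with `(i = b) ↦ False`. -/
def holds (φ : Face α) : Prop :=
  Quotient.lift holdsTerm (fun _ _ h => propext (holdsTerm_rel h)) φ

theorem holds_inf (φ ψ : Face α) : holds (φ ⊓ ψ) ↔ holds φ ∧ holds ψ := by
  obtain ⟨φ⟩ := φ; obtain ⟨ψ⟩ := ψ; rfl

theorem holds_sup (φ ψ : Face α) : holds (φ ⊔ ψ) ↔ holds φ ∨ holds ψ := by
  obtain ⟨φ⟩ := φ; obtain ⟨ψ⟩ := ψ; rfl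

/-- With every generator read as false, truth can only come from the constant `⊤`. Induction on the
formula turns this into equality with `⊤`, so `⊤` inherits primality from the truth values. -/
theorem holds_iff_eq_top {φ : Face α} : holds φ ↔ φ = ⊤ := by
  refine ⟨fun h => ?_, fun h => h ▸ trivial⟩
  induction φ using ind with
  | bot => exact h.elim
  | top => rfl
  | eq i b => exact h.elim
  | inf φ ψ hφ hψ =>
    rw [holds_inf] at h
    rw [hφ h.1, hψ h.2, inf_top_eq]
  | sup φ ψ hφ hψ =>
    rw [holds_sup] at h
    obtain h | h := h
    · rw [hφ h, top_sup_eq]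
    · rw [hψ h, sup_top_eq]

theorem bot_ne_top : (⊥ : Face α) ≠ ⊤ := fun h => holds_iff_eq_top.2 h

theorem eq_ne_top (i : α) (b : Bool) : eq i b ≠ ⊤ := fun h => holds_iff_eq_top.2 h

/-- The formula `1` is join-prime in the face lattice. -/
theorem sup_eq_top_iff {φ ψ : Face α} : φ ⊔ ψ = ⊤ ↔ φ = ⊤ ∨ ψ = ⊤ := by
  simp only [← holds_iff_eq_top, holds_sup]

theorem finset_sup_eq_top_iff {ι : Type*} (s : Finset ι) (φ : ι → Face α) :
    s.sup φ = ⊤ ↔ ∃ i ∈ s, φ i = ⊤ := by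
  classical
  induction s using Finset.induction_on with
  | empty => simpa using bot_ne_top
  | insert a s _ ih => simp [sup_eq_top_iff, ih]

theorem ofDM_ofBool (b : Bool) : ofDM (DM.ofBool b : DM α) b = ⊤ := by cases b <;> rfl

/-- Induction on `r`: a generator never gives `⊤`, and where `(r = b)` splits into a disjunction,
join-primality makes one disjunct `⊤`, which already fixes the value of the meet or join. -/
theorem eq_ofBool_of_ofDM_eq_top {r : DM α} {b : Bool} (h : ofDM r b = ⊤) :
    r = DM.ofBool b := by
  induction r using DM.ind generalizing b with
  | bot =>
    cases b
    · rfl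
    · exact (bot_ne_top h).elim
  | top =>
    cases b
    · exact (bot_ne_top h).elim
    · rfl
  | var a => exact (eq_ne_top a b h).elim
  | neg r ih =>
    rw [ofDM_neg] at h
    rw [ih h]
    cases b
    · exact DM.neg_top
    · exact DM.neg_bot
  | inf r s hr hs =>
    rw [ofDM_inf] at h
    cases b
    · obtain h | h := sup_eq_top_iff.1 h
      · rw [hr h]; exact bot_inf_eq _
      · rw [hs h]; exact inf_bot_eq _
    · obtain ⟨h, h'⟩ := inf_eq_top_iff.1 h
      rw [hr h, hs h', inf_idem]
  | sup r s hr hs =>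
    rw [ofDM_sup] at h
    cases b
    · obtain ⟨h, h'⟩ := inf_eq_top_iff.1 h
      rw [hr h, hs h', sup_idem]
    · obtain h | h := sup_eq_top_iff.1 h
      · rw [hr h]; exact top_sup_eq _
      · rw [hs h]; exact sup_top_eq _

theorem ofDM_eq_top_iff {r : DM α} {b : Bool} : ofDM r b = ⊤ ↔ r = DM.ofBool b :=
  ⟨eq_ofBool_of_ofDM_eq_top, fun h => h ▸ ofDM_ofBool b⟩

theorem subst_eq (f : α → DM β) (i : α) (b : Bool) : (eq i b).subst f = ofDM (f i) b := rfl

/-- The substitution that sets each `i` to its value under a partial assignment, and leaves it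
unchanged if it has none. -/
def assign (σ : α → Option Bool) (i : α) : DM α := (σ i).elim (DM.var i) DM.ofBool

theorem ofDM_assign_eq_top_iff {σ : α → Option Bool} {i : α} {b : Bool} :
    ofDM (assign σ i) b = ⊤ ↔ σ i = some b := by
  unfold assign
  obtain h | b' := σ i
  · exact iff_of_false (eq_ne_top i b) (by simp)
  · cases b <;> cases b'
    · exact iff_of_true rfl rfl
    · exact iff_of_false bot_ne_top (by simp)
    · exact iff_of_false bot_ne_top (by simp)
    · exact iff_of_true rfl rfl

/-- Face formulas are ordered by the faces on which they are true. -/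
theorem le_of_forall_assign {φ ψ : Face α}
    (h : ∀ σ : α → Option Bool, φ.subst (assign σ) = ⊤ → ψ.subst (assign σ) = ⊤) : φ ≤ ψ := by
  classical
  by_contra hle
  -- A prime ideal separating `φ` from `ψ` is read as a face on which `φ` is true and `ψ` is not.
  obtain ⟨P, hP, hψ, hdisj⟩ := DistribLattice.prime_ideal_of_disjoint_filter_ideal
    (F := Order.PFilter.principal φ) (I := Order.Ideal.principal ψ)
    (Set.disjoint_left.2 fun θ h₁ h₂ =>
      hle (le_trans (Order.PFilter.mem_principal.1 h₁) (Order.Ideal.mem_principal.1 h₂)))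
  have hφP : φ ∉ P := fun h => Set.disjoint_left.1 hdisj (Order.PFilter.mem_principal.2 le_rfl) h
  have hψP : ψ ∈ P := hψ (Order.Ideal.mem_principal.2 le_rfl)
  -- The equations outside `P` are the true ones. For each `i` at most one of the two is outside,
  -- since their meet `⊥` lies in the prime ideal `P`, so the order of the tests does not matter.
  let σ : α → Option Bool := fun i =>
    if eq i true ∉ P then some true else if eq i false ∉ P then some false else none
  have key : ∀ θ : Face α, θ ∉ P ↔ θ.subst (assign σ) = ⊤ := by
    intro θ
    induction θ using ind with
    | bot => exact iff_of_false (fun h => h P.bot_mem) bot_ne_top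
    | top => exact iff_of_true hP.top_notMem rfl
    | eq i b =>
      rw [subst_eq, ofDM_assign_eq_top_iff]
      have : eq i false ∈ P ∨ eq i true ∈ P :=
        hP.mem_or_mem (by rw [eq_inf_eq]; exact P.bot_mem)
      cases b <;> by_cases h₁ : eq i true ∈ P <;> by_cases h₂ : eq i false ∈ P <;>
        (simp [σ, h₁, h₂]; try tauto)
    | inf θ θ' h h' =>
      rw [subst_inf, inf_eq_top_iff, ← h, ← h', ← not_or, not_iff_not]
      exact ⟨hP.mem_or_mem, fun h => h.elim (P.lower inf_le_left) (P.lower inf_le_right)⟩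
    | sup θ θ' h h' =>
      rw [subst_sup, sup_eq_top_iff, ← h, ← h', ← not_and_or, Order.Ideal.sup_mem_iff]
  exact (key ψ).2 (h σ ((key φ).1 hφP)) hψP

/-- The partial assignment that records which names a substitution sends to an endpoint. -/
noncomputable def assignment (g : α → DM β) (i : α) : Option Bool :=
  open Classical in
  if g i = DM.ofBool true then some true else if g i = DM.ofBool false then some false else none

theorem ofBool_injective : Function.Injective (DM.ofBool : Bool → DM α) := by
  intro b b' h
  have h' := ofDM_eq_top_iff.2 h
  cases b <;> cases b'
  · rfl
  · exact (bot_ne_top h').elim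
  · exact (bot_ne_top h').elim
  · rfl

theorem assignment_eq_some_iff {g : α → DM β} {i : α} {b : Bool} :
    assignment g i = some b ↔ g i = DM.ofBool b := by
  have h : ¬ (g i = DM.ofBool true ∧ g i = DM.ofBool false) := fun h =>
    Bool.noConfusion (ofBool_injective (h.1.symm.trans h.2))
  unfold assignment
  cases b <;> split_ifs <;> simp_all

/-- A substitution satisfies the same face formulas as the smallest face that contains it. -/
theorem subst_assignment_eq_top_iff (g : α → DM β) (φ : Face α) :
    φ.subst (assign (assignment g)) = ⊤ ↔ φ.subst g = ⊤ := by
  induction φ using ind with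
  | bot => exact iff_of_false bot_ne_top bot_ne_top
  | top => exact iff_of_true rfl rfl
  | eq i b =>
    rw [subst_eq, subst_eq, ofDM_assign_eq_top_iff, ofDM_eq_top_iff, assignment_eq_some_iff]
  | inf φ ψ h h' => rw [subst_inf, subst_inf, inf_eq_top_iff, inf_eq_top_iff, h, h']
  | sup φ ψ h h' => rw [subst_sup, subst_sup, sup_eq_top_iff, sup_eq_top_iff, h, h']

/-- A substitution that already takes the values prescribed by `σ` factors through the face `σ`.
Faces are thus handled as idempotent endomaps of one cube, without changing its set of names. -/
theorem subst_assign_of_forall {σ : α → Option Bool} {g : α → DM β}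
    (h : ∀ i b, σ i = some b → g i = DM.ofBool b) (i : α) : (assign σ i).subst g = g i := by
  unfold assign
  obtain hi | ⟨b, hi⟩ := Option.eq_none_or_eq_some (σ i)
  · rw [hi]; rfl
  · rw [hi, h i b hi]; exact DM.subst_ofBool g b

theorem assign_subst_assign (σ : α → Option Bool) (i : α) :
    (assign σ i).subst (assign σ) = assign σ i :=
  subst_assign_of_forall (fun i b hb => by rw [assign, hb]; rfl) i

/-- Substitution as a homomorphism of bounded lattices. -/
def substHom (g : α → DM β) : BoundedLatticeHom (Face α) (Face β) where
  toFun := subst g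
  map_sup' := subst_sup g
  map_inf' := subst_inf g
  map_top' := rfl
  map_bot' := rfl

/-- The conjunction of the equations `(i = b)` in a partial assignment. -/
def conj [Fintype α] (σ : α → Option Bool) : Face α :=
  Finset.univ.inf fun i => (σ i).elim ⊤ (eq i)

/-- A meet is `⊤` only if each factor is, and `(g i = b)` is `⊤` only if `g i` is that endpoint:
`conj σ` thus defines the face `σ`. -/
theorem subst_conj_eq_top_iff [Fintype α] {σ : α → Option Bool} {g : α → DM β} :
    (conj σ).subst g = ⊤ ↔ ∀ i b, σ i = some b → g i = DM.ofBool b := by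
  have e : (conj σ).subst g = Finset.univ.inf fun i => ((σ i).elim ⊤ (eq i)).subst g :=
    map_finset_inf (substHom g) _ _
  rw [e, Finset.inf_eq_top_iff]
  simp only [Finset.mem_univ, true_implies]
  refine forall_congr' fun i => ?_
  obtain hi | ⟨b, hi⟩ := Option.eq_none_or_eq_some (σ i)
  · simp [hi, subst_top]
  · simp [hi, subst_eq, ofDM_eq_top_iff]

end Face

/-- The map of cubes given by a partial assignment. -/
def Cube.faceEndo (I : Cube) (σ : I.names → Option Bool) : I ⟶ I := Face.assign σ

/-- Face formulas are equal if they are true along the same maps of cubes. -/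
theorem Face.ext_of_subst_eq_top {I : Cube} {φ ψ : Face I.names}
    (h : ∀ ⦃J : Cube⦄ (g : J ⟶ I), φ.subst g = ⊤ ↔ ψ.subst g = ⊤) : φ = ψ :=
  le_antisymm (le_of_forall_assign fun σ => (h (J := I) (assign σ)).1)
    (le_of_forall_assign fun σ => (h (J := I) (assign σ)).2)

/-! ### Gluing face formulas -/

/-- A compatible family of face formulas defined on the extent `φ` is the restriction of a formula
`ψ ≤ φ`. -/
theorem Face.exists_glue {I : Cube} (φ : Face I.names)
    (Ψ : ∀ ⦃J : Cube⦄ (g : J ⟶ I), φ.subst g = ⊤ → Face J.names)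
    (hΨ : ∀ ⦃J K : Cube⦄ (g : J ⟶ I) (h : K ⟶ J) (hg : φ.subst g = ⊤)
      (hgh : φ.subst (h ≫ g) = ⊤), (Ψ g hg).subst h = Ψ (h ≫ g) hgh) :
    ∃ ψ : Face I.names, ∀ ⦃J : Cube⦄ (g : J ⟶ I),
      ψ.subst g = ⊤ ↔ ∃ hg : φ.subst g = ⊤, Ψ g hg = ⊤ := by
  classical
  have congr' : ∀ ⦃J : Cube⦄ {g g' : J ⟶ I}, g = g' → (∃ hg : φ.subst g = ⊤, Ψ g hg = ⊤) →
      ∃ hg : φ.subst g' = ⊤, Ψ g' hg = ⊤ := fun J g g' e h => e ▸ h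
  -- The disjunction of all faces `σ` of `I` that lie in `φ` and on which the family takes the value
  -- `⊤`.
  refine ⟨(Finset.univ.filter fun σ : I.names → Option Bool =>
    ∃ hg : φ.subst (assign σ) = ⊤, Ψ (J := I) (assign σ) hg = ⊤).sup conj, fun J g => ?_⟩
  have e := map_finset_sup (substHom g) (Finset.univ.filter fun σ : I.names → Option Bool =>
    ∃ hg : φ.subst (assign σ) = ⊤, Ψ (J := I) (assign σ) hg = ⊤) conj
  change Face.subst g _ = _ at e
  rw [e, finset_sup_eq_top_iff]
  constructor
  · rintro ⟨σ, hσ, hg⟩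
    obtain ⟨hσ, hσ'⟩ := (Finset.mem_filter.1 hσ).2
    -- As `g` factors through `σ`, compatibility makes the formula at `g` a restriction of the one
    -- at `σ`, which is `⊤`.
    have hg' : g ≫ I.faceEndo σ = g :=
      funext (subst_assign_of_forall (subst_conj_eq_top_iff.1 hg))
    refine congr' hg' ⟨?_, ?_⟩
    · exact (subst_subst _ _ φ).symm.trans ((congrArg (Face.subst g) hσ).trans rfl)
    · exact (hΨ (I.faceEndo σ) g hσ _).symm.trans (congrArg (Face.subst g) hσ')
  · rintro ⟨hg, hg'⟩
    have hs : φ.subst (assign (assignment g)) = ⊤ := (subst_assignment_eq_top_iff g φ).2 hg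
    have e₁ : g ≫ I.faceEndo (assignment g) = g :=
      funext (subst_assign_of_forall fun i b => assignment_eq_some_iff.1)
    have e₂ : I.faceEndo (assignment g) ≫ I.faceEndo (assignment g) =
        I.faceEndo (assignment g) :=
      funext (assign_subst_assign (assignment g))
    refine ⟨assignment g, Finset.mem_filter.2 ⟨Finset.mem_univ _, ?_⟩,
      subst_conj_eq_top_iff.2 fun i b => assignment_eq_some_iff.1⟩
    obtain ⟨h₁, h₂⟩ := congr' e₁.symm ⟨hg, hg'⟩
    -- Let `σ` be the smallest face containing `g`. The formula at `σ` becomes `⊤` along `g`, hence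
    -- along `σ` itself. By compatibility and idempotence of `σ`, this restriction is again the
    -- formula at `σ`.
    rw [← hΨ (I.faceEndo (assignment g)) g hs, ← subst_assignment_eq_top_iff] at h₂
    change Face.subst (I.faceEndo (assignment g)) _ = ⊤ at h₂
    have h₃ : φ.subst (I.faceEndo (assignment g) ≫ I.faceEndo (assignment g)) = ⊤ := by
      rw [e₂]; exact hs
    rw [hΨ (I.faceEndo (assignment g)) (I.faceEndo (assignment g)) hs h₃] at h₂
    exact congr' e₂ ⟨h₃, h₂⟩

/-! ### Extension operations, and contractions as terms of `isContr` -/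

namespace Ty

variable {Γ : CSet.{u}}

/-- A uniform operation that extends partial elements to total ones. -/
structure ExtensionStructure (A : Ty Γ) : Type u where
  ext : ∀ {x : Γ.Elements} (φ : Face x.1.unop.names), PartialElt A x φ → A.obj x
  map_ext : ∀ {x y : Γ.Elements} (k : x ⟶ y) (φ : Face x.1.unop.names) (u : PartialElt A x φ)
    (ψ : Face y.1.unop.names) (hψ : restrictFace k φ = ψ),
    A.map k (ext φ u) = ext ψ (u.restrict k ψ hψ)
  ext_top : ∀ {x : Γ.Elements} (φ : Face x.1.unop.names) (u : PartialElt A x φ)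
    (h : restrictFace (𝟙 x) φ = ⊤), ext φ u = u.val (𝟙 x) h

/-- An extension operation yields compositions, which do not depend on the base of the box. -/
def ExtensionStructure.compStructure {A : Ty Γ} (E : A.ExtensionStructure) : A.CompStructure where
  comp P := E.ext P.φ (P.u.restrict (P.sideHom true) P.φ (P.extent_side true))
  comp_restrict {I J i j hi} hj P f := by
    rw [E.map_ext (P.sideMap f hj true) P.φ _ (P.φ.subst f) rfl]
    refine congrArg (E.ext _) (PartialElt.ext ?_)
    funext y g hg
    refine P.u.val_congr (Subtype.ext ?_) _ _
    change (I.face i true).op ≫ f.op ≫ g.1 = (Cube.lift f i j).op ≫ (J.face j true).op ≫ g.1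
    rw [← Category.assoc, ← Category.assoc, ← op_comp, ← op_comp, Cube.face_lift f i hj]
  comp_top P h := by
    rw [E.ext_top _ _ ((restrictFace_id _ _).trans h)]
    exact P.u.val_congr (Category.comp_id _) _ _

/-- The data of a term of `isContr A`: a center and a uniform choice of paths from it. -/
structure Contraction (A : Ty Γ) : Type u where
  center : A.Ter
  path : ∀ {x : Γ.Elements}, A.obj x → A.obj (weaken x)
  path_zero : ∀ {x : Γ.Elements} (a : A.obj x), A.map (weakenFace x false) (path a) = center.1 x
  path_one : ∀ {x : Γ.Elements} (a : A.obj x), A.map (weakenFace x true) (path a) = a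
  map_path : ∀ {x y : Γ.Elements} (g : x ⟶ y) (a : A.obj x),
    A.map (weakenMap g) (path a) = path (A.map g a)

/-- The term of `isContr A` given by a contraction. -/
def Contraction.ter {A : Ty Γ} (C : A.Contraction) : A.isContr.Ter :=
  ⟨fun x => ⟨C.center.1 x, fun y g a => ⟨C.path (x := (CategoryOfElements.map A.p).obj y) a,
    (congrArg (fun k => A.map k (C.path a)) (Subtype.ext rfl)).trans
      ((C.path_zero a).trans ((C.center.2 ((CategoryOfElements.map A.p).map g)).symm.trans
        (A.q.2 g))),
    (congrArg (fun k => A.map k (C.path a)) (Subtype.ext rfl)).trans (C.path_one a)⟩,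
    fun _ _ _ h a => Subtype.ext
      ((congrArg (fun k => A.map k (C.path a)) (Subtype.ext rfl)).trans
        (C.map_path ((CategoryOfElements.map A.p).map h) a))⟩, fun {_ y} g =>
    sigma_ext A _ (C.center.2 g) ⟨𝟙 _, (Functor.map_id_apply A.total _ _).trans
      (congrArg (Sigma.mk y.2) (C.center.2 g))⟩ rfl rfl⟩

/-- The second components live in different fibers, so their agreement is recorded as transport
along a morphism over the identity. -/
theorem exists_hom_of_sigma_eq (A : Ty Γ) (B : Ty A.total) {x : Γ.Elements}
    {w w' : Σ a : A.obj x, B.obj (A.pt x a)} (h : w = w') :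
    ∃ g : A.pt x w.1 ⟶ A.pt x w'.1, g.1 = 𝟙 x.1 ∧ B.map g w.2 = w'.2 := by
  subst h
  exact ⟨𝟙 _, rfl, Functor.map_id_apply B _ _⟩

/-- The contraction given by a term of `isContr A`. -/
def contractionOfTer {A : Ty Γ} (t : A.isContr.Ter) : A.Contraction where
  center := ⟨fun x => (t.1 x).1, fun g => congrArg Sigma.fst (t.2 g)⟩
  path {x} a := ((t.1 x).2.1 (𝟙 _) a).1
  path_zero {x} a := (congrArg (fun k => A.map k ((t.1 x).2.1 (𝟙 _) a).1) (Subtype.ext rfl)).trans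
    ((t.1 x).2.1 (𝟙 _) a).2.1
  path_one {x} a := (congrArg (fun k => A.map k ((t.1 x).2.1 (𝟙 _) a).1) (Subtype.ext rfl)).trans
    ((t.1 x).2.1 (𝟙 _) a).2.2
  map_path {x y} g a := by
    obtain ⟨k, hk, e⟩ := exists_hom_of_sigma_eq A _ (t.2 g)
    -- Restricting the center along `g` gives the center at `y` only up to an equality; `k` corrects
    -- the target, so that `m` lies over `g`.
    let m : A.pt x (t.1 x).1 ⟶ A.pt y (t.1 y).1 := A.ptHom g (t.1 x).1 ≫ k
    have hm : (CategoryOfElements.map A.p).map m = g :=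
      Subtype.ext ((congrArg (g.1 ≫ ·) hk).trans (Category.comp_id _))
    have h₁ := congrArg Subtype.val ((t.1 x).2.2 (𝟙 _) m a)
    -- Compatibility of the term `t`: its function at `y` is the one at `x` restricted along `m`.
    have h₂ : ∀ b, (t.1 y).2.1 (𝟙 _) b = (t.1 x).2.1 (𝟙 _ ≫ m) b := fun b => by
      rw [← e]
      exact congrArg (fun l => (t.1 x).2.1 l b)
        ((congrArg (A.ptHom g (t.1 x).1 ≫ ·) (Category.comp_id k)).trans
          (Category.id_comp m).symm)
    refine Eq.trans ?_ (h₁.trans ?_)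
    · exact congrArg (fun k => A.map k ((t.1 x).2.1 (𝟙 _) a).1) (Subtype.ext (by rw [← hm]; rfl))
    · exact (congrArg Subtype.val (h₂ _)).symm.trans
        (congrArg (β := A.obj (weaken y)) (fun b : A.obj y => ((t.1 y).2.1 (𝟙 _) b).1)
          (congrArg (fun l : x ⟶ y => A.map l a) hm))

end Ty

/-! ### Contractibility of `T f` -/

section

variable {A B : CSet.{u}} {f : A ⟶ B}

theorem PartialPreimage.val_congr {x : B.Elements} {s t : PartialPreimage f x} (e : s = t)
    {y : B.Elements} (g : x ⟶ y) (hs : restrictFace g s.φ = ⊤) (ht : restrictFace g t.φ = ⊤) :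
    s.a.val g hs = t.a.val g ht := by
  subst e; rfl

/-- Partial elements of `T f` glue to a total one, of extent at most that of the partial element. -/
theorem exists_glue {x : B.Elements} {φ : Face x.1.unop.names} (u : Ty.PartialElt (T f) x φ) :
    ∃ ψ : Face x.1.unop.names, ∀ ⦃y : B.Elements⦄ (g : x ⟶ y),
      restrictFace g ψ = ⊤ ↔ ∃ hg : restrictFace g φ = ⊤, (u.val g hg).φ = ⊤ := by
  obtain ⟨ψ, hψ⟩ := Face.exists_glue φ (fun J g hg => (u.val (resHom x g) hg).φ) (by
    intro J K g h hg hgh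
    let k : res x g ⟶ res x (h ≫ g) := ⟨h.op, (Functor.map_comp_apply B g.op h.op x.2).symm⟩
    exact congrArg PartialPreimage.φ (u.map_val (resHom x g) k hg hgh))
  refine ⟨ψ, fun y g => ?_⟩
  obtain ⟨J, b⟩ := y
  obtain ⟨g, hg⟩ := g
  change x.1 ⟶ J at g
  change B.map g x.2 = b at hg
  subst hg
  exact hψ g.unop

/-- The element of `T f` glued from a partial element. -/
noncomputable def glue {x : B.Elements} (φ : Face x.1.unop.names)
    (u : Ty.PartialElt (T f) x φ) : PartialPreimage f x where
  φ := (exists_glue u).choose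
  a :=
    -- Where the glued extent is true, `u_g` is defined and has extent `⊤`, so it is total and its
    -- value at the identity can be taken.
    { val := fun y g hg =>
        (u.val g (((exists_glue u).choose_spec g).1 hg).1).a.val (𝟙 y)
          ((restrictFace_id y _).trans (((exists_glue u).choose_spec g).1 hg).2)
      map_val := fun y z g h hg hgh => by
        obtain ⟨hg, hg'⟩ := ((exists_glue u).choose_spec g).1 hg
        obtain ⟨hgh, hgh'⟩ := ((exists_glue u).choose_spec (g ≫ h)).1 hgh
        have hh : restrictFace (𝟙 y ≫ h) (u.val g hg).φ = ⊤ := by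
          rw [restrictFace_comp, restrictFace_id, hg']; rfl
        refine ((u.val g hg).a.map_val (𝟙 y) h _ hh).trans ?_
        refine Eq.trans ?_ (PartialPreimage.val_congr (u.map_val g h hg hgh) (𝟙 z) ?_ _)
        · exact (u.val g hg).a.val_congr ((Category.id_comp h).trans (Category.comp_id h).symm) _ _
        · exact (congrArg (restrictFace (𝟙 z)) (congrArg PartialPreimage.φ
            (u.map_val g h hg hgh))).trans ((restrictFace_id z _).trans hgh') }
  map_a y g hg := (u.val g (((exists_glue u).choose_spec g).1 hg).1).map_a (𝟙 y) _

theorem restrictFace_glue {x y : B.Elements} (φ : Face x.1.unop.names)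
    (u : Ty.PartialElt (T f) x φ) (g : x ⟶ y) : restrictFace g (glue φ u).φ = ⊤ ↔
      ∃ hg : restrictFace g φ = ⊤, (u.val g hg).φ = ⊤ :=
  (exists_glue u).choose_spec g

/-- Face formulas are equal if they are true along the same morphisms. -/
theorem Face.ext_of_restrictFace_eq_top {x : B.Elements} {φ ψ : Face x.1.unop.names}
    (h : ∀ ⦃y : B.Elements⦄ (g : x ⟶ y), restrictFace g φ = ⊤ ↔ restrictFace g ψ = ⊤) : φ = ψ :=
  Face.ext_of_subst_eq_top fun _ g => h (resHom x g)

/-- The extension operation of `T f`. -/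
noncomputable def T.extensionStructure (f : A ⟶ B) : (T f).ExtensionStructure where
  ext φ u := glue φ u
  map_ext {x y} k φ u ψ hψ := by
    -- The extent was obtained by choice, yet restriction respects it, because a formula is
    -- determined by where it is true.
    refine PartialPreimage.ext (Face.ext_of_restrictFace_eq_top fun z g => ?_)
      fun z g hs ht => rfl
    refine Iff.trans ?_ (restrictFace_glue _ _ g).symm
    refine Iff.trans ?_ ((restrictFace_glue φ u (k ≫ g)).trans ?_)
    · rw [restrictFace_comp]; rfl
    · subst hψ
      exact ⟨fun ⟨h, h'⟩ => ⟨(restrictFace_comp k g φ).symm.trans h, h'⟩,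
        fun ⟨h, h'⟩ => ⟨(restrictFace_comp k g φ).trans h, h'⟩⟩
  ext_top {x} φ u h := by
    have hφ : ∀ ⦃y : B.Elements⦄ (g : x ⟶ y), restrictFace g φ = ⊤ := fun y g => by
      rw [restrictFace_id] at h
      rw [h]; rfl
    -- On a total extent, every `u_g` is a restriction of the single element `u_1`.
    have e : ∀ ⦃y : B.Elements⦄ (g : x ⟶ y), (T f).map g (u.val (𝟙 x) h) = u.val g (hφ g) :=
      fun y g => (u.map_val (𝟙 x) g h (hφ _)).trans (u.val_congr (Category.id_comp g) _ _)
    refine PartialPreimage.ext (Face.ext_of_restrictFace_eq_top fun y g => ?_)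
      fun y g hs ht => ?_
    · rw [restrictFace_glue]
      have := congrArg PartialPreimage.φ (e g)
      change restrictFace g (u.val (𝟙 x) h).φ = _ at this
      rw [this]
      exact ⟨fun h => h.2, fun h => ⟨_, h⟩⟩
    · have h₁ := ((restrictFace_glue φ u g).1 hs).2
      refine (PartialPreimage.val_congr (e g) (𝟙 y) ?_ ((restrictFace_id y _).trans h₁)).symm.trans
        ((u.val (𝟙 x) h).a.val_congr (Category.comp_id g) _ _)
      exact (restrictFace_id y _).trans ht

/-- The element of `T f` with empty extent. -/
def emptyPreimage (x : B.Elements) : PartialPreimage f x where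
  φ := ⊥
  a :=
    { val := fun _ _ hg => (Face.bot_ne_top hg).elim
      map_val := fun _ _ _ _ hg => (Face.bot_ne_top hg).elim }
  map_a _ _ hg := (Face.bot_ne_top hg).elim

/-- The path from the empty element to `[φ ↦ a]`, of extent `(i = 1) ∧ φ`. -/
def pathFromEmpty {x : B.Elements} (s : PartialPreimage f x) : PartialPreimage f (Ty.weaken x) where
  φ := Face.ofDM (x.1.unop.last x.1.unop.fresh) true ⊓
    restrictFace (resHom x (x.1.unop.deg x.1.unop.fresh)) s.φ
  a :=
    { val := fun y g hg => s.a.val (resHom x (x.1.unop.deg x.1.unop.fresh) ≫ g) (by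
        rw [restrictFace_comp]
        exact (inf_eq_top_iff.1 ((Face.subst_inf _ _ _).symm.trans hg)).2)
      map_val := fun y z g h hg hgh => by
        refine (s.a.map_val _ h _ ?_).trans (s.a.val_congr (Category.assoc _ g h) _ _)
        rw [Category.assoc, restrictFace_comp]
        exact (inf_eq_top_iff.1 ((Face.subst_inf _ _ _).symm.trans hgh)).2 }
  map_a y g hg := s.map_a _ _

/-- The family `T f` contracts to its empty elements. -/
def T.contraction (f : A ⟶ B) : (T f).Contraction where
  center := ⟨fun x => emptyPreimage x, fun g =>
    PartialPreimage.ext rfl fun _ _ hs _ => (Face.bot_ne_top hs).elim⟩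
  path s := pathFromEmpty s
  path_zero {x} s := by
    refine PartialPreimage.ext ?_ fun _ _ _ ht => (Face.bot_ne_top ht).elim
    -- At `i = 0` the conjunct `(i = 1)` becomes `⊥`.
    refine (Face.subst_inf _ _ _).trans ?_
    rw [Face.subst_ofDM]
    refine (congrArg (fun r => Face.ofDM r true ⊓ _) (Cube.cons_last _ _ _)).trans ?_
    exact bot_inf_eq _
  path_one {x} s := by
    have e : resHom x (x.1.unop.deg x.1.unop.fresh) ≫ Ty.weakenFace x true = 𝟙 x :=
      Subtype.ext (congrArg Quiver.Hom.op
        (Cube.face_deg x.1.unop x.1.unop.fresh_notMem true))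
    refine PartialPreimage.ext ?_ fun y g hs ht => s.a.val_congr ?_ _ _
    -- At `i = 1` the first conjunct becomes `⊤`; the second loses its weakening, leaving `φ`.
    · refine (Face.subst_inf _ _ _).trans ?_
      rw [Face.subst_ofDM]
      refine (congrArg (fun r => Face.ofDM r true ⊓ _) (Cube.cons_last _ _ _)).trans ?_
      refine (top_inf_eq _).trans ?_
      exact (restrictFace_comp _ (Ty.weakenFace x true) s.φ).symm.trans
        ((congrArg (fun k => restrictFace k s.φ) e).trans (restrictFace_id x s.φ))
    · rw [← Category.assoc, e, Category.id_comp]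
  map_path {x y} g s := by
    have e : resHom x (x.1.unop.deg x.1.unop.fresh) ≫ Ty.weakenMap g =
        g ≫ resHom y (y.1.unop.deg y.1.unop.fresh) :=
      Subtype.ext (congrArg Quiver.Hom.op
        (Cube.lift_deg g.1.unop x.1.unop.fresh_notMem y.1.unop.fresh))
    refine PartialPreimage.ext ?_ fun z h hs ht => s.a.val_congr ?_ _ _
    · refine (Face.subst_inf _ _ _).trans ?_
      rw [Face.subst_ofDM]
      refine congrArg₂ (fun r φ => Face.ofDM r true ⊓ φ) (Cube.cons_last _ _ _) ?_
      exact (restrictFace_comp _ (Ty.weakenMap g) s.φ).symm.trans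
        ((congrArg (fun k => restrictFace k s.φ) e).trans (restrictFace_comp g _ s.φ))
    · rw [← Category.assoc, e, Category.assoc]

theorem T.isContractible (f : A ⟶ B) : (T f).IsContractible :=
  ⟨⟨(T.extensionStructure f).compStructure⟩, ⟨(T.contraction f).ter⟩⟩

end

/-! ### From contractibility to an extension operation -/

namespace Ty

variable {Γ : CSet.{u}}

/-- The morphism `(i = r)` from a weakened element back to the element. -/
def weakenAt (x : Γ.Elements) (r : DM x.1.unop.names) : weaken x ⟶ x :=
  ⟨(Cube.cons (𝟙 x.1.unop) x.1.unop.fresh r).op, by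
    change Γ.map _ (Γ.map _ x.2) = x.2
    rw [← Functor.map_comp_apply, ← op_comp, Cube.cons_deg _ x.1.unop.fresh_notMem]
    exact Functor.map_id_apply Γ _ x.2⟩

theorem weakenAt_comp {x y : Γ.Elements} (g : x ⟶ y) (r : DM x.1.unop.names) :
    weakenAt x r ≫ g = weakenMap g ≫ weakenAt y (r.subst g.1.unop) := by
  refine Subtype.ext (congrArg Quiver.Hom.op ?_)
  exact (Cube.comp_cons g.1.unop (𝟙 _) _ r).trans
    (Eq.trans (by rw [Category.comp_id, Category.id_comp])
      (Cube.cons_lift (𝟙 _) g.1.unop _ y.1.unop.fresh_notMem _).symm)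

theorem PartialElt.val_congr_of_val_eq {A : Ty Γ} {x : Γ.Elements} {φ : Face x.1.unop.names}
    (u : PartialElt A x φ) {y z : Γ.Elements} (g : x ⟶ y) (g' : x ⟶ z) (k : y ⟶ z)
    (e : g.1 ≫ k.1 = g'.1) (hg : restrictFace g φ = ⊤) (hg' : restrictFace g' φ = ⊤) :
    A.map k (u.val g hg) = u.val g' hg' := by
  obtain rfl : g ≫ k = g' := Subtype.ext e
  exact u.map_val g k hg hg'

/-- Equal boxes have equal compositions. -/
theorem CompStructure.comp_congr {A : Ty Γ} (C : A.CompStructure) {I : Cube} {i : ℕ}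
    {hi : i ∉ I.names} (P Q : Box A I i hi) (hρ : P.ρ = Q.ρ) (hφ : P.φ = Q.φ)
    (hu : ∀ ⦃y : Γ.Elements⦄ (g : Γ.elementsMk (op (I.extend i)) P.ρ ⟶ y)
      (g' : Γ.elementsMk (op (I.extend i)) Q.ρ ⟶ y) (_ : g.1 = g'.1)
      (hg : restrictFace g (P.φ.subst (I.deg i)) = ⊤)
      (hg' : restrictFace g' (Q.φ.subst (I.deg i)) = ⊤), P.u.val g hg = Q.u.val g' hg')
    (ha : ∀ k : P.side false ⟶ Q.side false, k.1 = 𝟙 _ → A.map k P.a₀ = Q.a₀)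
    (k : P.side true ⟶ Q.side true) (hk : k.1 = 𝟙 _) : A.map k (C.comp P) = C.comp Q := by
  obtain ⟨ρ, φ, u, a₀, hP⟩ := P
  obtain ⟨ρ', φ', u', a₀', hQ⟩ := Q
  obtain rfl : ρ = ρ' := hρ
  obtain rfl : φ = φ' := hφ
  obtain rfl : u = u' := PartialElt.ext (by funext y g hg; exact hu g g rfl hg hg)
  obtain rfl : a₀ = a₀' := (map_of_val_eq_id A (𝟙 _) rfl a₀).symm.trans (ha (𝟙 _) rfl)
  exact map_of_val_eq_id A k hk _

namespace Contraction

variable {A : Ty Γ} (D : A.Contraction)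

/-- The endpoint laws are put as implications because `r` arises by substitution and is only
provably an endpoint. -/
theorem map_weakenAt_ofBool {x : Γ.Elements} {r : DM x.1.unop.names} (a : A.obj x) :
    (r = ⊥ → A.map (weakenAt x r) (D.path a) = D.center.1 x) ∧
      (r = ⊤ → A.map (weakenAt x r) (D.path a) = a) := by
  constructor
  · rintro rfl; exact D.path_zero a
  · rintro rfl; exact D.path_one a

theorem map_map_path {x y : Γ.Elements} (g : x ⟶ y) (r : DM x.1.unop.names)
    (s : DM y.1.unop.names) (hs : r.subst g.1.unop = s) (a : A.obj x) :
    A.map g (A.map (weakenAt x r) (D.path a)) = A.map (weakenAt y s) (D.path (A.map g a)) := by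
  subst hs
  rw [← D.map_path, ← Functor.map_comp_apply, ← Functor.map_comp_apply, weakenAt_comp]

/-- The box whose sides are the paths from the center to a partial element. -/
def box {x : Γ.Elements} (φ : Face x.1.unop.names) (u : PartialElt A x φ) :
    Box A x.1.unop x.1.unop.fresh x.1.unop.fresh_notMem where
  -- The line in the base is constant at `x`, so both ends of the box lie over `x`.
  ρ := (weaken x).2
  φ := φ
  u :=
    -- A map `g` into `I, i` sends `i` to some point of the interval; the side at `g` is the path
    -- from the center to the corresponding value of `u`, evaluated at that point.
    { val := fun y g hg => A.map (weakenAt y ((x.1.unop.last x.1.unop.fresh).subst g.1.unop))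
        (D.path (u.val (resHom x (x.1.unop.deg x.1.unop.fresh) ≫ g)
          ((restrictFace_comp _ g φ).trans hg)))
      map_val := fun y z g h hg hgh => by
        refine (D.map_map_path h _ ((x.1.unop.last x.1.unop.fresh).subst (g ≫ h).1.unop)
          (DM.subst_subst _ _ _) _).trans ?_
        refine congrArg (fun a => A.map _ (D.path a)) ?_
        exact u.val_congr_of_val_eq _ _ h (Category.assoc _ _ _) _ _ }
  a₀ := D.center.1 _
  compat y g hg hg' := by
    refine (D.center.2 g).trans ((D.map_weakenAt_ofBool _).1 ?_).symm
    refine (DM.subst_subst _ _ _).symm.trans ?_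
    exact (congrArg (DM.subst g.1.unop) (Cube.cons_last _ _ _)).trans rfl

/-- The morphism from `ρ (i1)` back to `x`, for the box at `x`. -/
def sideToBase {x : Γ.Elements} (φ : Face x.1.unop.names) (u : PartialElt A x φ) :
    (D.box φ u).side true ⟶ x :=
  ⟨𝟙 _, (Functor.map_id_apply Γ _ _).trans (weakenFace x true).2⟩

/-- Contractible types have an extension operation. -/
def extensionStructure (C : A.CompStructure) : A.ExtensionStructure where
  -- On `φ` the composition is the end at `i = 1` of these paths, which is `u`. The stage `ρ (i1)`
  -- equals `x` only propositionally, hence the transport.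
  ext φ u := A.map (D.sideToBase φ u) (C.comp (D.box φ u))
  map_ext {x y} k φ u ψ hψ := by
    subst hψ
    let P := D.box φ u
    let Q := D.box (restrictFace k φ) (u.restrict k _ rfl)
    have hρ : (P.restrict k.1.unop y.1.unop.fresh_notMem).ρ = Q.ρ := (weakenMap k).2
    let m : (P.restrict k.1.unop y.1.unop.fresh_notMem).side true ⟶ Q.side true :=
      ⟨𝟙 _, (Functor.map_id_apply Γ _ _).trans (congrArg (Γ.map _) hρ)⟩
    -- Uniformity of composition speaks of the restricted box; it has the same data as the box of
    -- the restricted partial element, over a provably equal base point.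
    have h := C.comp_congr (P.restrict k.1.unop y.1.unop.fresh_notMem) Q hρ rfl ?_ ?_ m rfl
    · rw [← h, ← C.comp_restrict]
      refine (Functor.map_comp_apply A _ _ _).symm.trans ?_
      refine Eq.trans ?_ (Functor.map_comp_apply A _ _ _)
      refine Eq.trans ?_ (Functor.map_comp_apply A _ _ _)
      refine congrArg (fun l => A.map l _) (Subtype.ext ?_)
      change 𝟙 _ ≫ k.1 = k.1 ≫ 𝟙 _ ≫ 𝟙 _
      simp
    · intro z g g' e hg hg'
      refine congrArg₂ (fun r a => A.map (weakenAt z r) (D.path a)) ?_ (u.val_congr ?_ _ _)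
      · refine (DM.subst_subst _ _ _).symm.trans ?_
        exact (congrArg (DM.subst g.1.unop) (Cube.cons_last _ _ _)).trans
          (congrArg (fun l => DM.subst (Quiver.Hom.unop l) (y.1.unop.last y.1.unop.fresh)) e)
      · refine Subtype.ext ?_
        change (x.1.unop.deg _).op ≫ (Cube.lift k.1.unop _ _).op ≫ g.1 =
          k.1 ≫ (y.1.unop.deg _).op ≫ g'.1
        rw [← e, ← Category.assoc, ← Category.assoc, ← op_comp,
          Cube.lift_deg _ x.1.unop.fresh_notMem, op_comp]
        rfl
    · intro l hl
      exact (congrArg (A.map l) (D.center.2 _)).trans (D.center.2 l)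
  ext_top {x} φ u h := by
    rw [C.comp_top (D.box φ u) ((restrictFace_id x φ).symm.trans h)]
    refine (congrArg (A.map _) ((D.map_weakenAt_ofBool _).2 ?_)).trans ?_
    · exact Cube.cons_last _ _ _
    · refine u.val_congr_of_val_eq _ _ _ ?_ _ _
      exact (Category.comp_id _).trans (congrArg Quiver.Hom.op
        (Cube.face_deg x.1.unop x.1.unop.fresh_notMem true))

end Contraction

end Ty

/-! ### Lifting `toTotal f` against types with an extension operation -/

theorem Ty.map_snd_congr {Γ : CSet.{u}} (E : Ty Γ) {J : Cubeᵒᵖ} {p p' : E.total.obj J}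
    (h : p = p') {z : Γ.Elements} (l : Γ.elementsMk J p.1 ⟶ z) (l' : Γ.elementsMk J p'.1 ⟶ z)
    (e : l.1 = l'.1) : E.map l p.2 = E.map l' p'.2 := by
  subst h
  obtain rfl : l = l' := Subtype.ext e
  rfl

section

variable {A B : CSet.{u}} {f : A ⟶ B}

/-- The element `a_g` of the partial element `a` in `w = (b, [φ ↦ a])`. -/
abbrev partialVal {I J : Cubeᵒᵖ} (w : (T f).total.obj I) (g : I ⟶ J)
    (hg : w.2.φ.subst g.unop = ⊤) : A.obj J :=
  w.2.a.val (⟨g, rfl⟩ : B.elementsMk I w.1 ⟶ B.elementsMk J (B.map g w.1)) hg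

theorem map_partialVal {I J K : Cubeᵒᵖ} (w : (T f).total.obj I) (g : I ⟶ J) (k : J ⟶ K)
    (hg : w.2.φ.subst g.unop = ⊤) (hgk : w.2.φ.subst (g ≫ k).unop = ⊤) :
    A.map k (partialVal w g hg) = partialVal w (g ≫ k) hgk :=
  w.2.a.val_congr_of_val_eq _ _
    (⟨k, (Functor.map_comp_apply B g k w.1).symm⟩ :
      B.elementsMk J (B.map g w.1) ⟶ B.elementsMk K (B.map (g ≫ k) w.1)) rfl hg hgk

theorem partialVal_eq {I : Cubeᵒᵖ} (w : (T f).total.obj I) {y : B.Elements}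
    (g : B.elementsMk I w.1 ⟶ y) (hg : restrictFace g w.2.φ = ⊤) :
    w.2.a.val g hg = partialVal w g.1 hg :=
  (Functor.map_id_apply A _ _).symm.trans (w.2.a.val_congr_of_val_eq g _
    (⟨𝟙 _, (Functor.map_id_apply B _ _).trans g.2.symm⟩ : y ⟶ B.elementsMk y.1 (B.map g.1 w.1))
      (Category.comp_id _) _ _)

/-- On its extent, `[φ ↦ a]` restricts to `[1 ↦ a]`. -/
theorem toTotal_partialVal {I J : Cubeᵒᵖ} (w : (T f).total.obj I) (g : I ⟶ J)
    (hg : w.2.φ.subst g.unop = ⊤) :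
    (toTotal f).app J (partialVal w g hg) = (T f).total.map g w := by
  have e := w.2.map_a (⟨g, rfl⟩ : B.elementsMk I w.1 ⟶ B.elementsMk J (B.map g w.1)) hg
  refine Ty.total_ext (T f) e ⟨𝟙 J, (Functor.map_id_apply B _ _).trans e⟩ rfl ?_
  refine PartialPreimage.ext hg.symm fun y h _ ht => ?_
  refine (congrArg (fun k => A.map k (partialVal w g hg)) (Category.id_comp h.1)).trans ?_
  refine (map_partialVal w g h.1 hg ?_).trans ?_
  · exact (Face.subst_subst _ _ _).symm.trans (congrArg (Face.subst h.1.unop) hg)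
  · exact (partialVal_eq w ((⟨g, rfl⟩ : B.elementsMk I w.1 ⟶ B.elementsMk J (B.map g w.1)) ≫ h)
      _).symm

variable {Γ : CSet.{u}} {E : Ty Γ} {α : A ⟶ E.total} {β : (T f).total ⟶ Γ}

/-- By the commuting square the left side is `β` at the image of `a_g`, and `toTotal_partialVal`
identifies that image with `w g`. This places `α(a_g)` in the right fiber of `E`. -/
theorem fst_app_partialVal (h : toTotal f ≫ β = α ≫ E.p) {I J : Cubeᵒᵖ} (w : (T f).total.obj I)
    (g : I ⟶ J) (hg : w.2.φ.subst g.unop = ⊤) :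
    (α.app J (partialVal w g hg)).1 = Γ.map g (β.app I w) := by
  have e := ConcreteCategory.congr_hom (NatTrans.congr_app h J) (partialVal w g hg)
  exact e.symm.trans ((congrArg (β.app J) (toTotal_partialVal w g hg)).trans
    (NatTrans.naturality_apply β g w))

/-- The morphism along which the elements of `imagePartialElt` are transported. -/
def fiberHom (h : toTotal f ≫ β = α ≫ E.p) {I : Cubeᵒᵖ} (w : (T f).total.obj I) {y : Γ.Elements}
    (g : Γ.elementsMk I (β.app I w) ⟶ y) (hg : restrictFace g w.2.φ = ⊤) :
    Γ.elementsMk y.1 (α.app y.1 (partialVal w g.1 hg)).1 ⟶ y :=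
  ⟨𝟙 y.1, (Functor.map_id_apply Γ _ _).trans ((fst_app_partialVal h w g.1 hg).trans g.2)⟩

/-- The image in `E` of the partial element `a` of `w = (b, [φ ↦ a])`. -/
def imagePartialElt (h : toTotal f ≫ β = α ≫ E.p) {I : Cubeᵒᵖ} (w : (T f).total.obj I) :
    Ty.PartialElt E (Γ.elementsMk I (β.app I w)) w.2.φ where
  val _ g hg := E.map (fiberHom h w g hg) (α.app _ (partialVal w g.1 hg)).2
  map_val y z g k hg hgk := by
    refine (Functor.map_comp_apply E _ _ _).symm.trans ?_
    have e : α.app z.1 (partialVal w (g ≫ k).1 hgk) =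
        E.total.map k.1 (α.app y.1 (partialVal w g.1 hg)) :=
      (congrArg (α.app z.1) (map_partialVal w g.1 k.1 hg hgk)).symm.trans
        (NatTrans.naturality_apply α k.1 _)
    let p := α.app y.1 (partialVal w g.1 hg)
    let m : Γ.elementsMk z.1 (Γ.map k.1 p.1) ⟶ z :=
      ⟨𝟙 z.1, (Functor.map_id_apply Γ _ _).trans
        ((congrArg (Γ.map k.1) ((fst_app_partialVal h w g.1 hg).trans g.2)).trans k.2)⟩
    -- By naturality of `α`, both sides are transports of one element `p.2` along morphisms with the
    -- same underlying map `k`.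
    refine Eq.trans ?_ (Ty.map_snd_congr E e _ m rfl).symm
    exact (Ty.map_map E _ m _ ((Category.comp_id _).trans (Category.id_comp k.1).symm) p.2).symm

theorem partialVal_map {I J K : Cubeᵒᵖ} (w : (T f).total.obj I) (k : I ⟶ J) (g : J ⟶ K)
    (hg : ((T f).total.map k w).2.φ.subst g.unop = ⊤) (hkg : w.2.φ.subst (k ≫ g).unop = ⊤) :
    partialVal ((T f).total.map k w) g hg = partialVal w (k ≫ g) hkg :=
  partialVal_eq w ((⟨k, rfl⟩ : B.elementsMk I w.1 ⟶ B.elementsMk J (B.map k w.1)) ≫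
    (⟨g, rfl⟩ : B.elementsMk J (B.map k w.1) ⟶ B.elementsMk K _)) hkg

/-- Holds since `(a k)_g = a_{k g}`; together with uniformity of extension it makes the lift
natural. -/
theorem imagePartialElt_restrict (h : toTotal f ≫ β = α ≫ E.p) {I J : Cubeᵒᵖ}
    (w : (T f).total.obj I) (k : I ⟶ J)
    (e : Γ.map k (β.app I w) = β.app J ((T f).total.map k w)) :
    (imagePartialElt h w).restrict
      (⟨k, e⟩ : Γ.elementsMk I (β.app I w) ⟶ Γ.elementsMk J (β.app J ((T f).total.map k w)))
      ((T f).total.map k w).2.φ rfl = imagePartialElt h ((T f).total.map k w) := by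
  refine Ty.PartialElt.ext ?_
  funext y g hg
  exact Ty.map_snd_congr E (congrArg (α.app y.1) (partialVal_map w k g.1 hg _).symm) _ _ rfl

/-- The action on stages of the lift of a square from `toTotal f` to the projection of a type with
an extension operation. -/
def totalLiftApp (X : E.ExtensionStructure) (h : toTotal f ≫ β = α ≫ E.p) (I : Cubeᵒᵖ)
    (w : (T f).total.obj I) : E.total.obj I :=
  ⟨β.app I w, X.ext w.2.φ (imagePartialElt h w)⟩

theorem map_totalLiftApp (X : E.ExtensionStructure) (h : toTotal f ≫ β = α ≫ E.p) {I J : Cubeᵒᵖ}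
    (k : I ⟶ J) (w : (T f).total.obj I) :
    E.total.map k (totalLiftApp X h I w) = totalLiftApp X h J ((T f).total.map k w) := by
  have e : Γ.map k (β.app I w) = β.app J ((T f).total.map k w) :=
    (NatTrans.naturality_apply β k w).symm
  let m : Γ.elementsMk I (β.app I w) ⟶ Γ.elementsMk J (β.app J ((T f).total.map k w)) := ⟨k, e⟩
  have hφ : restrictFace m w.2.φ = ((T f).total.map k w).2.φ := rfl
  have e₂ := (X.map_ext m w.2.φ (imagePartialElt h w) _ hφ).trans
    (congrArg (fun u => X.ext _ u) (imagePartialElt_restrict h w k e))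
  refine Ty.total_ext E e ⟨𝟙 J, (Functor.map_id_apply Γ _ _).trans e⟩ rfl ?_
  exact (Ty.map_map E _ _ m (Category.comp_id k) _).trans e₂

/-- The lift of a square from `toTotal f` to the projection of a type with an extension
operation. -/
def totalLift (X : E.ExtensionStructure) (h : toTotal f ≫ β = α ≫ E.p) :
    (T f).total ⟶ E.total where
  app I := ↾(totalLiftApp X h I)
  naturality {I J} k := by
    ext w : 3
    exact (map_totalLiftApp X h k w).symm

/-- The extent of `[1 ↦ a]` is `⊤`, so extension returns the value of the partial element at the
identity, which is `α a` up to transport. -/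
theorem totalLiftApp_toTotal (X : E.ExtensionStructure) (h : toTotal f ≫ β = α ≫ E.p)
    (I : Cubeᵒᵖ) (a : A.obj I) : totalLiftApp X h I ((toTotal f).app I a) = α.app I a := by
  have e : β.app I ((toTotal f).app I a) = (α.app I a).1 :=
    ConcreteCategory.congr_hom (NatTrans.congr_app h I) a
  have ea : α.app I (partialVal ((toTotal f).app I a) (𝟙 I) rfl) = α.app I a :=
    congrArg (α.app I) (Functor.map_id_apply A _ a)
  refine Ty.total_ext E e ⟨𝟙 I, (Functor.map_id_apply Γ _ _).trans e⟩ rfl ?_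
  refine (congrArg (E.map _) (X.ext_top _ _ rfl)).trans ?_
  refine (Functor.map_comp_apply E _ _ _).symm.trans ?_
  exact (Ty.map_snd_congr E ea _ (𝟙 _) (Category.comp_id _)).trans
    (Functor.map_id_apply E _ _)

/-- The map `toTotal f` has the left lifting property against the projections of types with an
extension operation. -/
theorem hasLiftingProperty_of_extensionStructure (f : A ⟶ B) (X : E.ExtensionStructure) :
    HasLiftingProperty (toTotal f) E.p where
  sq_hasLift {α β} sq := ⟨⟨{
    l := totalLift X sq.w.symm
    fac_left := by
      ext I : 2
      exact ConcreteCategory.hom_ext _ _ fun a => totalLiftApp_toTotal X sq.w.symm I a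
    fac_right := rfl }⟩⟩

end

end CubicalSets

/-- For every map `f : A ⟶ B` of cubical sets, the family `T_f` over `B` is contractible, and the map
`a ↦ (f a, [1 ↦ a])` from `A` to `(b : B) × T_f(b)` is a cofibration. -/
theorem mainTheorem8 {A B : CubicalSets.CSet.{u}} (f : A ⟶ B) :
    (CubicalSets.T f).IsContractible ∧ CubicalSets.cofibrations (CubicalSets.toTotal f) := by
  refine ⟨CubicalSets.T.isContractible f, ?_⟩
  rintro _ _ _ ⟨Γ, E, ⟨C⟩, ⟨t⟩⟩
  exact CubicalSets.hasLiftingProperty_of_extensionStructure f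
    ((CubicalSets.Ty.contractionOfTer t).extensionStructure C)
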